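/- Let $N=\{1,\dots,d\}$ and let $f_\gamma:2^N\to\mathbb R$, $\gamma\sim p(\gamma)$, be a stochastic set function whose mean $f(S)=\mathbb E_\gamma[f_\gamma(S)]$ is nonnegative, monotone and submodular. Let $D_f\ge 0$ bound its marginal returns in the sense that $\mathbb E_\gamma\big[\max_{S\subseteq N,\,i\in N}|f_\gamma(S\cup\{i\})-f_\gamma(S)|^2\big]\le D_f^2$. Let $F(\mathbf x)=\sum_{S\subseteq N} f(S)\prod_{i\in S}x_i\prod_{i\notin S}(1-x_i)$ be the multilinear extension of $f$. Let $\mathcal I$ be a matroid on $N$ of rank $r\ge 1$, let $\mathcal C=\mathrm{conv}\{\mathbf 1_I: I\in\mathcal I\}$ be its matroid polytope, and let $\mathbf x^*\in\arg\max_{\mathbf x\in\mathcal C}F(\mathbf x)$. For $\mathbf x\in[0,1]^d$ let $p(\mathbf z,\gamma;\mathbf x)=p(\gamma)\prod_{i=1}^d x_i^{z_i}(1-x_i)^{1-z_i}$ for $\mathbf z\in\{0,1\}^d$, and put $N(\mathbf z)=\{i: z_i=1\}$. For a sample $(\mathbf z,\gamma)$ define the discrete Hessian estimator $H(\mathbf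 z,\gamma)\in\mathbb R^{d\times d}$ by $H_{ii}=0$ and, for $i\ne j$, $$H_{ij}=f_\gamma(N(\mathbf z)\cup\{i,j\})-f_\gamma((N(\mathbf z)\cup\{i\})\setminus\{j\})-f_\gamma((N(\mathbf z)\cup\{j\})\setminus\{i\})+f_\gamma(N(\mathbf z)\setminus\{i,j\}).$$ Let $\epsilon>0$ with $1/\epsilon\in\mathbb N$. The algorithm SCG++ with $T=1/\epsilon$ rounds and minibatch sizes $|\mathcal M_0|=\lceil 1/(2r^2\epsilon^2)\rceil$ and $|\mathcal M|=2/\epsilon$ starts at $\mathbf x^0=0$ and performs, for $t=0,1,\dots,T-1$: * if $t=0$: draw $|\mathcal M_0|$ independent samples $(\mathbf z_k,\gamma_k)\sim p(\mathbf z,\gamma;\mathbf x^0)$ and set $[\mathbf g^0]_i=\frac1{|\mathcal M_0|}\sum_k \big(f_{\gamma_k}(N(\mathbf z_k)\cup\{i\})-f_{\gamma_k}(N(\mathbf z_k)\setminus\{i\})\big)$; * if $t\ge1$: draw, independently for $k=1,\dots,|\mathcal M|$ and of the past given $\mathbf x^{t-1},\mathbf x^t$, $a_k$ uniform on $[0,1]$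 and then $(\mathbf z_k,\gamma_k)\sim p(\mathbf z,\gamma;a_k\mathbf x^t+(1-a_k)\mathbf x^{t-1})$, and set $\mathbf g^t=\mathbf g^{t-1}+\Big(\frac1{|\mathcal M|}\sum_k H(\mathbf z_k,\gamma_k)\Big)(\mathbf x^t-\mathbf x^{t-1})$; * choose $\mathbf v^t\in\arg\max_{\mathbf v\in\mathcal C}\langle\mathbf v,\mathbf g^t\rangle$ (by any fixed measurable selection $\mathbf g\mapsto \mathbf v$) and set $\mathbf x^{t+1}=\mathbf x^t+\frac1T\mathbf v^t$. Then the Hessian estimator is unbiased, i.e. $\mathbb E_{(\mathbf z,\gamma)\sim p(\cdot;\mathbf x)}[H_{ij}(\mathbf z,\gamma)]=\partial^2F(\mathbf x)/\partial x_i\partial x_j$ for all $\mathbf x\in[0,1]^d$ and all $i,j$, and $$\mathbb E\big[F(\mathbf x^{1/\epsilon})\big]\ \ge\ (1-1/e)\,F(\mathbf x^*)-6\sqrt{r^3d}\,D_f\,\epsilon .$$ -/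

import Mathlib

open MeasureTheory ProbabilityTheory

namespace SCGPP

variable {d : ℕ} {Γ : Type*} [MeasurableSpace Γ]

/-! Set functions on the ground set `N = Fin d`. -/

/-- Submodularity: `f (A ∪ B) + f (A ∩ B) ≤ f A + f B` for all `A, B`. -/
def IsSubmodular (f : Finset (Fin d) → ℝ) : Prop :=
  ∀ A B : Finset (Fin d), f (A ∪ B) + f (A ∩ B) ≤ f A + f B

/-- The mean set function `f S = E_γ [f_γ S]`. -/
noncomputable def meanSetFn (μ : Measure Γ) (fγ : Γ → Finset (Fin d) → ℝ) :
    Finset (Fin d) → ℝ :=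
  fun S => ∫ γ, fγ γ S ∂μ

/-- The largest marginal return (in absolute value) of a set function. -/
noncomputable def maxMarginal (f : Finset (Fin d) → ℝ) : ℝ :=
  ⨆ p : Finset (Fin d) × Fin d, |f (insert p.2 p.1) - f p.1|

/-- The marginal returns of the stochastic set function are bounded by `Df` in mean square:
`E_γ [(max_{S, i} |f_γ (S ∪ {i}) - f_γ S|) ^ 2] ≤ Df ^ 2`. -/
def HasBoundedMarginals (μ : Measure Γ) (fγ : Γ → Finset (Fin d) → ℝ) (Df : ℝ) : Prop :=
  0 ≤ Df ∧ Integrable (fun γ => maxMarginal (fγ γ) ^ 2) μ ∧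
    ∫ γ, maxMarginal (fγ γ) ^ 2 ∂μ ≤ Df ^ 2

/-- The multilinear extension `F x = ∑_S f S ∏_{i ∈ S} x_i ∏_{i ∉ S} (1 - x_i)`. -/
noncomputable def multilinearExt (f : Finset (Fin d) → ℝ) (x : Fin d → ℝ) : ℝ :=
  ∑ S : Finset (Fin d), f S * ((∏ i ∈ S, x i) * ∏ i ∈ Sᶜ, (1 - x i))

/-- The second-order partial derivative `∂²F / ∂x_i ∂x_j`. -/
noncomputable def hessianEntry (F : (Fin d → ℝ) → ℝ) (x : Fin d → ℝ) (i j : Fin d) : ℝ :=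
  fderiv ℝ (fun y => fderiv ℝ F y (Pi.single j 1)) x (Pi.single i 1)

/-- The matroid polytope: the convex hull of the indicator vectors of the independent sets. -/
def matroidPolytope (𝓘 : Matroid (Fin d)) : Set (Fin d → ℝ) :=
  convexHull ℝ {x | ∃ I : Set (Fin d), 𝓘.Indep I ∧ x = Set.indicator I 1}

/-! Samples and estimators. A sample is a pair `(γ, z)` with `z : Fin d → Bool`. -/

/-- `N(z)`, the set of coordinates with `z_i = 1`. -/
def supp (z : Fin d → Bool) : Finset (Fin d) := Finset.univ.filter fun i => z i = true

/-- The law `p(z, γ; x) = p(γ) ∏_i Ber(z_i; x_i)`, for `x ∈ [0, 1]^d`. (Outside the unit cube,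
which the algorithm never leaves, the parameter is clamped to `[0, 1]`.) -/
noncomputable def sampleLaw (μ : Measure Γ) (x : Fin d → ℝ) : Measure (Γ × (Fin d → Bool)) :=
  μ.prod (Measure.pi fun i => bernoulliMeasure true false (Set.projIcc (0 : ℝ) 1 zero_le_one (x i)))

/-- The law of `(γ, z)` when `a` is uniform on `[0, 1]` and, given `a`, the pair `(γ, z)` follows
`p(z, γ; a x' + (1 - a) x)`. -/
noncomputable def segmentLaw (μ : Measure Γ) (x x' : Fin d → ℝ) :
    Measure (Γ × (Fin d → Bool)) :=
  (volume.restrict (Set.Icc (0 : ℝ) 1)).bind fun a => sampleLaw μ (a • x' + (1 - a) • x)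

/-- One-sample gradient estimator:
`i`-th entry `f_γ (N(z) ∪ {i}) - f_γ (N(z) \ {i})`. -/
def gradSample (fγ : Γ → Finset (Fin d) → ℝ) (ω : Γ × (Fin d → Bool)) : Fin d → ℝ :=
  fun i => fγ ω.1 (supp ω.2 ∪ {i}) - fγ ω.1 (supp ω.2 \ {i})

/-- One-sample discrete Hessian estimator: zero on the diagonal, and for `i ≠ j` the second
difference of `f_γ` at `N(z)` in the directions `i` and `j`. -/
def hessSample (fγ : Γ → Finset (Fin d) → ℝ) (ω : Γ × (Fin d → Bool)) :
    Matrix (Fin d) (Fin d) ℝ :=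
  Matrix.of fun i j =>
    if i = j then 0 else
      fγ ω.1 (supp ω.2 ∪ {i, j}) - fγ ω.1 ((supp ω.2 ∪ {i}) \ {j})
        - fγ ω.1 ((supp ω.2 ∪ {j}) \ {i}) + fγ ω.1 (supp ω.2 \ {i, j})

/-- The average of the gradient estimator over a minibatch. -/
noncomputable def gradBatch (fγ : Γ → Finset (Fin d) → ℝ) {m : ℕ}
    (ω : Fin m → Γ × (Fin d → Bool)) : Fin d → ℝ :=
  (m : ℝ)⁻¹ • ∑ k, gradSample fγ (ω k)

/-- The average of the Hessian estimator over a minibatch. -/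
noncomputable def hessBatch (fγ : Γ → Finset (Fin d) → ℝ) {m : ℕ}
    (ω : Fin m → Γ × (Fin d → Bool)) : Matrix (Fin d) (Fin d) ℝ :=
  (m : ℝ)⁻¹ • ∑ k, hessSample fγ (ω k)

/-! The algorithm. The state `(x, g)` at round `t` is the pair `(x^t, g^t)`. -/

/-- `lmo g ∈ argmax_{v ∈ C} ⟨v, g⟩` for every `g`. -/
def IsArgmaxOracle (C : Set (Fin d → ℝ)) (lmo : (Fin d → ℝ) → (Fin d → ℝ)) : Prop :=
  ∀ g, lmo g ∈ C ∧ ∀ v ∈ C, v ⬝ᵥ g ≤ lmo g ⬝ᵥ g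

/-- `x^{t+1} = x^t + (1/T) v^t` where `v^t = lmo g^t`. -/
noncomputable def nextPoint (T : ℕ) (lmo : (Fin d → ℝ) → (Fin d → ℝ))
    (s : (Fin d → ℝ) × (Fin d → ℝ)) : Fin d → ℝ :=
  s.1 + (1 / (T : ℝ)) • lmo s.2

/-- The conditional law of `(x^{t+1}, g^{t+1})` given `(x^t, g^t)`: with `M` independent samples
from the segment between `x^t` and `x^{t+1}`, and `H` the average of their Hessian estimators,
`g^{t+1} = g^t + H (x^{t+1} - x^t)`. -/
noncomputable def stepLaw (μ : Measure Γ) (fγ : Γ → Finset (Fin d) → ℝ) (T M : ℕ)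
    (lmo : (Fin d → ℝ) → (Fin d → ℝ)) (s : (Fin d → ℝ) × (Fin d → ℝ)) :
    Measure ((Fin d → ℝ) × (Fin d → ℝ)) :=
  (Measure.pi fun _ : Fin M => segmentLaw μ s.1 (nextPoint T lmo s)).map fun ω =>
    (nextPoint T lmo s, s.2 + (hessBatch fγ ω).mulVec (nextPoint T lmo s - s.1))

/-- The law of `(x^t, g^t)`: `x^0 = 0`, and `g^0` is the average gradient estimator over `M₀`
independent samples from `p(z, γ; x^0)`. -/
noncomputable def stateLaw (μ : Measure Γ) (fγ : Γ → Finset (Fin d) → ℝ) (T M₀ M : ℕ)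
    (lmo : (Fin d → ℝ) → (Fin d → ℝ)) : ℕ → Measure ((Fin d → ℝ) × (Fin d → ℝ))
  | 0 => (Measure.pi fun _ : Fin M₀ => sampleLaw μ (0 : Fin d → ℝ)).map fun ω =>
      (0, gradBatch fγ ω)
  | t + 1 => (stateLaw μ fγ T M₀ M lmo t).bind (stepLaw μ fγ T M lmo)

/-- The law of the iterate `x^t`. -/
noncomputable def iterateLaw (μ : Measure Γ) (fγ : Γ → Finset (Fin d) → ℝ) (T M₀ M : ℕ)
    (lmo : (Fin d → ℝ) → (Fin d → ℝ)) : ℕ → Measure (Fin d → ℝ)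
  | 0 => Measure.dirac 0
  | t + 1 => (stateLaw μ fγ T M₀ M lmo t).map (nextPoint T lmo)

/-! All laws above depend measurably on their parameters, so that every `Measure.bind` and
`Measure.map` is the genuine one. -/

instance isProbabilityMeasure_sampleLaw (μ : Measure Γ) [IsProbabilityMeasure μ]
    (x : Fin d → ℝ) : IsProbabilityMeasure (sampleLaw μ x) := by
  unfold sampleLaw; infer_instance

theorem measurable_pi_law {α β : Type*} [MeasurableSpace α] [MeasurableSpace β] {ι : Type*}
    [Fintype ι] (κ : ι → α → Measure β) [∀ i a, IsProbabilityMeasure (κ i a)]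
    (hκ : ∀ i, Measurable (κ i)) : Measurable fun a => Measure.pi fun i => κ i a := by
  refine Measurable.measure_of_isPiSystem_of_isProbabilityMeasure
    generateFrom_pi.symm isPiSystem_pi ?_
  rintro s ⟨t, ht, rfl⟩
  simp only [Measure.pi_pi]
  exact Finset.measurable_prod _ fun i _ =>
    (Measure.measurable_coe (ht i (Set.mem_univ i))).comp (hκ i)

theorem measurable_iid_law {α β : Type*} [MeasurableSpace α] [MeasurableSpace β]
    {κ : α → Measure β} [∀ a, IsProbabilityMeasure (κ a)] (hκ : Measurable κ) (m : ℕ) :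
    Measurable fun a => Measure.pi fun _ : Fin m => κ a :=
  measurable_pi_law (fun _ => κ) fun _ => hκ

theorem measurable_bernoulli : Measurable fun p : unitInterval =>
    (bernoulliMeasure true false p : Measure Bool) := by
  refine Measure.measurable_of_measurable_coe _ fun s hs => ?_
  simp only [bernoulliMeasure_def, Measure.add_apply, Measure.smul_apply]
  have h : Measurable unitInterval.toNNReal := measurable_subtype_coe.subtype_mk
  have h' : Measurable fun p : unitInterval => unitInterval.toNNReal (unitInterval.symm p) :=
    h.comp unitInterval.continuous_symm.measurable
  exact ((measurable_coe_nnreal_ennreal.comp h).mul_const _).add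
    ((measurable_coe_nnreal_ennreal.comp h').mul_const _)

theorem measurable_sampleLaw (μ : Measure Γ) [IsProbabilityMeasure μ] :
    Measurable (sampleLaw (d := d) μ) := by
  have h : Measurable fun x : Fin d → ℝ => (Measure.pi fun i =>
      (bernoulliMeasure true false (Set.projIcc (0 : ℝ) 1 zero_le_one (x i)) : Measure Bool)) := by
    refine measurable_pi_law _ fun i => measurable_bernoulli.comp ?_
    exact continuous_projIcc.measurable.comp (measurable_pi_apply i)
  refine Measurable.measure_of_isPiSystem_of_isProbabilityMeasure
    generateFrom_prod.symm isPiSystem_prod ?_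
  rintro s ⟨u, hu, v, hv, rfl⟩
  simp only [sampleLaw, Measure.prod_prod]
  exact ((Measure.measurable_coe (show MeasurableSet v from hv)).comp h).const_mul _

instance isProbabilityMeasure_segmentLaw (μ : Measure Γ) [IsProbabilityMeasure μ]
    (x x' : Fin d → ℝ) : IsProbabilityMeasure (segmentLaw μ x x') := by
  have : IsProbabilityMeasure (volume.restrict (Set.Icc (0 : ℝ) 1)) := ⟨by simp⟩
  have h : Measurable fun a : ℝ => sampleLaw μ (a • x' + (1 - a) • x) :=
    (measurable_sampleLaw μ).comp (by fun_prop)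
  refine ⟨?_⟩
  rw [segmentLaw, Measure.bind_apply MeasurableSet.univ h.aemeasurable]
  simp

theorem measurable_segmentLaw {α : Type*} [MeasurableSpace α] (μ : Measure Γ)
    [IsProbabilityMeasure μ] {p q : α → Fin d → ℝ} (hp : Measurable p) (hq : Measurable q) :
    Measurable fun b => segmentLaw μ (p b) (q b) := by
  refine Measure.measurable_of_measurable_coe _ fun s hs => ?_
  have h : ∀ b, segmentLaw μ (p b) (q b) s =
      ∫⁻ a in Set.Icc (0 : ℝ) 1, sampleLaw μ (a • q b + (1 - a) • p b) s := fun b =>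
    Measure.bind_apply hs ((measurable_sampleLaw μ).comp (by fun_prop)).aemeasurable
  simp only [h]
  refine Measurable.lintegral_prod_right'
    (f := fun c : α × ℝ => sampleLaw μ (c.2 • q c.1 + (1 - c.2) • p c.1) s) ?_
  exact (Measure.measurable_coe hs).comp ((measurable_sampleLaw μ).comp (by fun_prop))

theorem measurable_eval_supp {fγ : Γ → Finset (Fin d) → ℝ} (hf : ∀ S, Measurable fun γ => fγ γ S)
    (φ : Finset (Fin d) → Finset (Fin d)) :
    Measurable fun ω : Γ × (Fin d → Bool) => fγ ω.1 (φ (supp ω.2)) :=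
  measurable_from_prod_countable_left fun z => hf (φ (supp z))

theorem measurable_gradBatch {fγ : Γ → Finset (Fin d) → ℝ}
    (hf : ∀ S, Measurable fun γ => fγ γ S) (m : ℕ) :
    Measurable (gradBatch fγ (m := m)) := by
  have h : Measurable (gradSample fγ) := measurable_pi_lambda _ fun i =>
    (measurable_eval_supp hf (· ∪ {i})).sub (measurable_eval_supp hf (· \ {i}))
  unfold gradBatch
  fun_prop

theorem measurable_hessBatch {fγ : Γ → Finset (Fin d) → ℝ}
    (hf : ∀ S, Measurable fun γ => fγ γ S) (m : ℕ) (i j : Fin d) :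
    Measurable fun ω : Fin m → Γ × (Fin d → Bool) => hessBatch fγ ω i j := by
  have h : Measurable fun ω : Γ × (Fin d → Bool) => hessSample fγ ω i j := by
    by_cases hij : i = j
    · simp [hessSample, hij]
    · simp only [hessSample, Matrix.of_apply, if_neg hij]
      exact (((measurable_eval_supp hf (· ∪ {i, j})).sub
        (measurable_eval_supp hf fun S => (S ∪ {i}) \ {j})).sub
        (measurable_eval_supp hf fun S => (S ∪ {j}) \ {i})).add
        (measurable_eval_supp hf (· \ {i, j}))
  simp only [hessBatch, Matrix.smul_apply, Matrix.sum_apply]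
  fun_prop

theorem measurable_nextPoint (T : ℕ) {lmo : (Fin d → ℝ) → (Fin d → ℝ)} (hl : Measurable lmo) :
    Measurable (nextPoint T lmo) := by
  unfold nextPoint
  fun_prop

theorem measurable_map_law {α β δ : Type*} [MeasurableSpace α] [MeasurableSpace β]
    [MeasurableSpace δ] {κ : α → Measure β} [∀ a, IsProbabilityMeasure (κ a)] (hκ : Measurable κ)
    {G : α → β → δ} (hG : Measurable fun p : α × β => G p.1 p.2) :
    Measurable fun a => (κ a).map (G a) := by
  refine Measure.measurable_of_measurable_coe _ fun u hu => ?_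
  let K : Kernel α β := ⟨κ, hκ⟩
  have : IsMarkovKernel K := ⟨fun a => inferInstanceAs (IsProbabilityMeasure (κ a))⟩
  have h := Kernel.measurable_kernel_prodMk_left (κ := K) (hG hu)
  have e : ∀ a, (κ a).map (G a) u = K a (Prod.mk a ⁻¹' ((fun p : α × β => G p.1 p.2) ⁻¹' u)) :=
    fun a => Measure.map_apply (hG.comp measurable_prodMk_left) hu
  simpa only [e] using h

theorem measurable_stepLaw (μ : Measure Γ) [IsProbabilityMeasure μ]
    {fγ : Γ → Finset (Fin d) → ℝ} (hf : ∀ S, Measurable fun γ => fγ γ S) (T M : ℕ)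
    {lmo : (Fin d → ℝ) → (Fin d → ℝ)} (hl : Measurable lmo) :
    Measurable (stepLaw μ fγ T M lmo) := by
  have hn := measurable_nextPoint T hl
  have hκ : Measurable fun s : (Fin d → ℝ) × (Fin d → ℝ) =>
      Measure.pi fun _ : Fin M => segmentLaw μ s.1 (nextPoint T lmo s) := by
    have h2 : Measurable fun s : (Fin d → ℝ) × (Fin d → ℝ) =>
        segmentLaw μ s.1 (nextPoint T lmo s) := measurable_segmentLaw μ measurable_fst hn
    exact measurable_iid_law h2 M
  have hG : Measurable fun p : ((Fin d → ℝ) × (Fin d → ℝ)) × (Fin M → Γ × (Fin d → Bool)) =>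
      (hessBatch fγ p.2).mulVec (nextPoint T lmo p.1 - p.1.1) := by
    refine measurable_pi_lambda _ fun i => ?_
    change Measurable fun p : ((Fin d → ℝ) × (Fin d → ℝ)) × (Fin M → Γ × (Fin d → Bool)) =>
      ∑ j, hessBatch fγ p.2 i j * (nextPoint T lmo p.1 - p.1.1) j
    refine Finset.measurable_sum _ fun j _ => ?_
    have h1 : Measurable fun p : ((Fin d → ℝ) × (Fin d → ℝ)) × (Fin M → Γ × (Fin d → Bool)) =>
        hessBatch fγ p.2 i j := (measurable_hessBatch hf M i j).comp measurable_snd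
    have h2 : Measurable fun p : ((Fin d → ℝ) × (Fin d → ℝ)) × (Fin M → Γ × (Fin d → Bool)) =>
        (nextPoint T lmo p.1 - p.1.1) j := by
      have := hn
      simp only [Pi.sub_apply]
      fun_prop
    exact h1.mul h2
  have hG' : Measurable fun p : ((Fin d → ℝ) × (Fin d → ℝ)) × (Fin M → Γ × (Fin d → Bool)) =>
      (nextPoint T lmo p.1, p.1.2 + (hessBatch fγ p.2).mulVec (nextPoint T lmo p.1 - p.1.1)) :=
    (hn.comp measurable_fst).prodMk ((measurable_snd.comp measurable_fst).add hG)
  exact measurable_map_law (κ := fun s : (Fin d → ℝ) × (Fin d → ℝ) =>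
      Measure.pi fun _ : Fin M => segmentLaw μ s.1 (nextPoint T lmo s))
    (G := fun s ω => (nextPoint T lmo s,
      s.2 + (hessBatch fγ ω).mulVec (nextPoint T lmo s - s.1))) hκ hG'

end SCGPP

/-! The multilinear extension is affine in each coordinate, so its partial derivative in direction i
is the multilinear extension of the discrete derivative of `f` at i. Its Hessian entries are
therefore extensions of second discrete differences. For x in the cube, the average of h_γ(N(z))
over a sample is the extension of the mean of h. Since `hessSample` is exactly a second difference
evaluated at N(z), it is unbiased.

The guarantee combines two estimates.

Variance (`lintegral_gradError_stateLaw_le`): sampling at a uniform point of the segment from x to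
x' makes the mean of H(x' - x) equal to ∇F(x') - ∇F(x), by the fundamental theorem of calculus.
Hence a round adds only centred noise to g - ∇F(x), and expected squared errors add up. An entry of
H is at most twice the largest marginal and ‖x' - x‖₁ ≤ r/T, so a round costs at most d (2r/T)² Df²
/ M. With the given batch sizes the total stays below 4 d r² ε² Df².

Progress (`multilinearExt_nextPoint_ge`): monotonicity and the marginal bound keep the second
differences of the mean above -Df, so a step of ℓ¹-length at most r/T loses at most Df (r/T)²/2
against its linearization. Monotone submodularity gives F(y) - F(x) ≤ ⟨y, ∇F(x)⟩. Replacing ∇F by g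
in the linear maximization costs ⟨v - y, g - ∇F⟩, which is split by Young's inequality using ‖v -
y‖² ≤ 2r.

In expectation this is a contraction with factor 1 - 1/T, and unrolling T rounds yields 1 - 1/e. The
Young parameter stays free until the end and is then optimized. -/

namespace SCGPP

/-! ### Multilinear extensions: discrete derivatives as partial derivatives, and submodularity -/

section SetFunctions

variable {d : ℕ}

/-- The discrete derivative `S ↦ f (S ∪ {i}) - f (S \ {i})` of a set function. -/
def discreteDeriv (i : Fin d) (f : Finset (Fin d) → ℝ) : Finset (Fin d) → ℝ :=
  fun S => f (insert i S) - f (S.erase i)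

/-- Pairs each set t avoiding i with t ∪ {i}; the two weights differ only in the factor 1 - x_i or
x_i. -/
theorem multilinearExt_eq_sum_powerset (f : Finset (Fin d) → ℝ) (x : Fin d → ℝ) (i : Fin d) :
    multilinearExt f x = ∑ t ∈ (Finset.univ.erase i).powerset,
      ((∏ j ∈ t, x j) * ∏ j ∈ (insert i t)ᶜ, (1 - x j)) *
        ((1 - x i) * f t + x i * f (insert i t)) := by
  have hi : i ∉ (Finset.univ.erase i : Finset (Fin d)) := Finset.notMem_erase i _
  have hu : (Finset.univ : Finset (Finset (Fin d))) =
      (insert i (Finset.univ.erase i : Finset (Fin d))).powerset := by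
    rw [Finset.insert_erase (Finset.mem_univ i), Finset.powerset_univ]
  rw [multilinearExt, hu, Finset.sum_powerset_insert hi, ← Finset.sum_add_distrib]
  refine Finset.sum_congr rfl fun t ht => ?_
  have hit : i ∉ t := fun h => hi (Finset.mem_powerset.1 ht h)
  have hc : tᶜ = insert i (insert i t)ᶜ := by
    ext j; by_cases hj : j = i <;> simp [hj, hit]
  rw [hc, Finset.prod_insert (by simp), Finset.prod_insert hit]
  ring

/-- Conditioning on whether i belongs to the random set. Both coefficients are extensions of set
functions that ignore i, so by `multilinearExt_update` they do not depend on x_i. -/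
theorem multilinearExt_eq_affine (f : Finset (Fin d) → ℝ) (x : Fin d → ℝ) (i : Fin d) :
    multilinearExt f x = (1 - x i) * multilinearExt (fun S => f (S.erase i)) x
      + x i * multilinearExt (fun S => f (insert i S)) x := by
  simp only [multilinearExt_eq_sum_powerset _ x i, Finset.mul_sum, ← Finset.sum_add_distrib]
  refine Finset.sum_congr rfl fun t ht => ?_
  have hit : i ∉ t := fun h => Finset.notMem_erase i _ (Finset.mem_powerset.1 ht h)
  rw [Finset.insert_idem, Finset.erase_insert hit, Finset.erase_eq_of_notMem hit]
  ring

theorem multilinearExt_update {f : Finset (Fin d) → ℝ} {i : Fin d}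
    (hf : ∀ S, f (insert i S) = f (S.erase i)) (x : Fin d → ℝ) (c : ℝ) :
    multilinearExt f (Function.update x i c) = multilinearExt f x := by
  simp only [multilinearExt_eq_sum_powerset _ _ i]
  refine Finset.sum_congr rfl fun t ht => ?_
  have hit : i ∉ t := fun h => Finset.notMem_erase i _ (Finset.mem_powerset.1 ht h)
  have h1 : ∏ j ∈ t, Function.update x i c j = ∏ j ∈ t, x j :=
    Finset.prod_congr rfl fun j hj => by
      rw [Function.update_of_ne (by rintro rfl; exact hit hj)]
  have h2 : ∏ j ∈ (insert i t)ᶜ, (1 - Function.update x i c j) = ∏ j ∈ (insert i t)ᶜ, (1 - x j) :=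
    Finset.prod_congr rfl fun j hj => by
      rw [Function.update_of_ne (by rintro rfl; simp at hj)]
  rw [h1, h2, hf, Finset.erase_eq_of_notMem hit]
  ring

theorem multilinearExt_sub (f g : Finset (Fin d) → ℝ) (x : Fin d → ℝ) :
    multilinearExt (fun S => f S - g S) x = multilinearExt f x - multilinearExt g x := by
  simp [multilinearExt, sub_mul, Finset.sum_sub_distrib]

theorem multilinearExt_add (f g : Finset (Fin d) → ℝ) (x : Fin d → ℝ) :
    multilinearExt (fun S => f S + g S) x = multilinearExt f x + multilinearExt g x := by
  simp [multilinearExt, add_mul, Finset.sum_add_distrib]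

theorem multilinearExt_mul_const (f : Finset (Fin d) → ℝ) (c : ℝ) (x : Fin d → ℝ) :
    multilinearExt (fun S => f S * c) x = multilinearExt f x * c := by
  simp only [multilinearExt, Finset.sum_mul]
  exact Finset.sum_congr rfl fun _ _ => by ring

theorem multilinearExt_sum {ι : Type*} (s : Finset ι) (f : ι → Finset (Fin d) → ℝ)
    (x : Fin d → ℝ) :
    multilinearExt (fun S => ∑ k ∈ s, f k S) x = ∑ k ∈ s, multilinearExt (f k) x := by
  simp only [multilinearExt, Finset.sum_mul]
  exact Finset.sum_comm

theorem multilinearExt_const (c : ℝ) (x : Fin d → ℝ) :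
    multilinearExt (fun _ => c) x = c := by
  have h := Finset.prod_add x (fun i => 1 - x i) Finset.univ
  simp only [add_sub_cancel, Finset.prod_const_one, Finset.powerset_univ,
    ← Finset.compl_eq_univ_sdiff] at h
  rw [multilinearExt, ← Finset.mul_sum, ← h, mul_one]

theorem multilinearExt_indicator_mem (i : Fin d) (x : Fin d → ℝ) :
    multilinearExt (fun S => if i ∈ S then 1 else 0) x = x i := by
  rw [multilinearExt_eq_affine _ x i]
  simp [multilinearExt_const]

theorem multilinearExt_mono {f g : Finset (Fin d) → ℝ} (h : ∀ S, f S ≤ g S) {x : Fin d → ℝ}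
    (hx : x ∈ Set.Icc (0 : Fin d → ℝ) 1) : multilinearExt f x ≤ multilinearExt g x := by
  refine Finset.sum_le_sum fun S _ => mul_le_mul_of_nonneg_right (h S) (mul_nonneg ?_ ?_)
  · exact Finset.prod_nonneg fun i _ => hx.1 i
  · exact Finset.prod_nonneg fun i _ => sub_nonneg.2 (hx.2 i)

theorem multilinearExt_zero (f : Finset (Fin d) → ℝ) :
    multilinearExt f (0 : Fin d → ℝ) = f ∅ := by
  rw [multilinearExt, Finset.sum_eq_single ∅]
  · simp
  · intro S _ hS
    obtain ⟨i, hi⟩ := Finset.nonempty_iff_ne_empty.2 hS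
    rw [Finset.prod_eq_zero hi rfl]
    simp
  · simp

theorem contDiff_multilinearExt (f : Finset (Fin d) → ℝ) {n : WithTop ℕ∞} :
    ContDiff ℝ n (multilinearExt f) := by
  unfold multilinearExt
  refine ContDiff.sum fun S _ => contDiff_const.mul (ContDiff.mul ?_ ?_)
  · exact contDiff_prod fun i _ => contDiff_apply ℝ ℝ i
  · exact contDiff_prod fun i _ => contDiff_const.sub (contDiff_apply ℝ ℝ i)

theorem differentiable_multilinearExt (f : Finset (Fin d) → ℝ) :
    Differentiable ℝ (multilinearExt f) :=
  (contDiff_multilinearExt f (n := 1)).differentiable one_ne_zero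

theorem continuous_multilinearExt (f : Finset (Fin d) → ℝ) :
    Continuous (multilinearExt f) := (differentiable_multilinearExt f).continuous

/-- Exact, without remainder, because the extension is affine along each coordinate line. -/
theorem multilinearExt_add_smul_single (f : Finset (Fin d) → ℝ) (x : Fin d → ℝ) (i : Fin d)
    (t : ℝ) : multilinearExt f (x + t • Pi.single i 1) =
      multilinearExt f x + t * multilinearExt (discreteDeriv i f) x := by
  have hx : x + t • Pi.single i 1 = Function.update x i (x i + t) := by
    ext j
    by_cases hj : j = i
    · subst hj; simp
    · simp [hj]
  have hins : ∀ S : Finset (Fin d), insert i (S.erase i) = insert i S := fun S => by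
    ext j; by_cases hj : j = i <;> simp [hj]
  rw [hx, multilinearExt_eq_affine f _ i, multilinearExt_update (by simp),
    multilinearExt_update (by simp [hins]), multilinearExt_eq_affine f x i]
  unfold discreteDeriv
  rw [multilinearExt_sub, Function.update_self]
  ring

theorem fderiv_multilinearExt_single (f : Finset (Fin d) → ℝ) (x : Fin d → ℝ) (i : Fin d) :
    fderiv ℝ (multilinearExt f) x (Pi.single i 1) = multilinearExt (discreteDeriv i f) x := by
  -- The Fréchet derivative yields a line derivative, which must agree with the slope of the affine
  -- restriction.
  have h := ((differentiable_multilinearExt f x).hasFDerivAt).hasLineDerivAt (Pi.single i (1 : ℝ))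
  have h' : HasLineDerivAt ℝ (multilinearExt f) (multilinearExt (discreteDeriv i f) x) x
      (Pi.single i 1) := by
    unfold HasLineDerivAt
    simp only [multilinearExt_add_smul_single]
    simpa using ((hasDerivAt_id (0 : ℝ)).mul_const
      (multilinearExt (discreteDeriv i f) x)).const_add (multilinearExt f x)
  exact HasDerivAt.unique h h'

theorem fderiv_multilinearExt (f : Finset (Fin d) → ℝ) (x u : Fin d → ℝ) :
    fderiv ℝ (multilinearExt f) x u = ∑ i, u i * multilinearExt (discreteDeriv i f) x := by
  conv_lhs => rw [pi_eq_sum_univ' u]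
  simp only [map_sum, map_smul, smul_eq_mul]
  refine Finset.sum_congr rfl fun i _ => ?_
  rw [← fderiv_multilinearExt_single]

theorem hessianEntry_multilinearExt (f : Finset (Fin d) → ℝ) (x : Fin d → ℝ) (i j : Fin d) :
    hessianEntry (multilinearExt f) x i j =
      multilinearExt (discreteDeriv i (discreteDeriv j f)) x := by
  unfold hessianEntry
  simp only [fderiv_multilinearExt_single]

theorem hasDerivAt_multilinearExt_line (f : Finset (Fin d) → ℝ) (x u : Fin d → ℝ) (a : ℝ) :
    HasDerivAt (fun a : ℝ => multilinearExt f (x + a • u))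
      (∑ i, u i * multilinearExt (discreteDeriv i f) (x + a • u)) a := by
  rw [← fderiv_multilinearExt]
  have h2 : HasDerivAt (fun a : ℝ => x + a • u) u a := by
    simpa using ((hasDerivAt_id a).smul_const u).const_add x
  exact (differentiable_multilinearExt f _).hasFDerivAt.comp_hasDerivAt a h2

/-- The fundamental theorem of calculus for a multilinear extension on a segment. -/
theorem integral_multilinearExt_segment (f : Finset (Fin d) → ℝ) (x x' : Fin d → ℝ) :
    ∫ a in Set.Icc (0 : ℝ) 1, ∑ i, (x' - x) i *
        multilinearExt (discreteDeriv i f) (a • x' + (1 - a) • x) =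
      multilinearExt f x' - multilinearExt f x := by
  have hseg : ∀ a : ℝ, a • x' + (1 - a) • x = x + a • (x' - x) := fun a => by
    ext j; simp; ring
  simp only [hseg]
  rw [integral_Icc_eq_integral_Ioc, ← intervalIntegral.integral_of_le zero_le_one,
    intervalIntegral.integral_eq_sub_of_hasDerivAt
      (fun a _ => hasDerivAt_multilinearExt_line f x (x' - x) a)]
  · simp
  · refine Continuous.intervalIntegrable ?_ _ _
    refine continuous_finsetSum _ fun i _ => continuous_const.mul ?_
    exact (continuous_multilinearExt _).comp (by fun_prop)

theorem segment_mem_cube {x x' : Fin d → ℝ} (hx : x ∈ Set.Icc (0 : Fin d → ℝ) 1)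
    (hx' : x' ∈ Set.Icc (0 : Fin d → ℝ) 1) {a : ℝ} (ha : a ∈ Set.Icc (0 : ℝ) 1) :
    a • x' + (1 - a) • x ∈ Set.Icc (0 : Fin d → ℝ) 1 :=
  convex_Icc _ _ hx' hx ha.1 (sub_nonneg.2 ha.2) (by ring)

/-- First-order lower bound: if all discrete derivatives of `g` are at least `-K`, then the
multilinear extension decreases at most at rate `K` along nonnegative directions. -/
theorem multilinearExt_sub_le_add {g : Finset (Fin d) → ℝ} {K : ℝ}
    (hg : ∀ i S, -K ≤ discreteDeriv i g S) {x u : Fin d → ℝ} (hu : 0 ≤ u)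
    (hx : x ∈ Set.Icc (0 : Fin d → ℝ) 1) (hxu : x + u ∈ Set.Icc (0 : Fin d → ℝ) 1) :
    multilinearExt g x - K * ∑ i, u i ≤ multilinearExt g (x + u) := by
  rw [← sub_nonneg]
  have h := integral_multilinearExt_segment g x (x + u)
  have h0 : ∫ a in Set.Icc (0 : ℝ) 1, (-K * ∑ i, u i) = -K * ∑ i, u i := by simp
  have h1 : ∫ a in Set.Icc (0 : ℝ) 1, (-K * ∑ i, u i) ≤
      ∫ a in Set.Icc (0 : ℝ) 1, ∑ i, (x + u - x) i *
        multilinearExt (discreteDeriv i g) (a • (x + u) + (1 - a) • x) := by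
    refine setIntegral_mono_on (continuous_const.integrableOn_Icc) ?_ measurableSet_Icc ?_
    · refine Continuous.integrableOn_Icc (continuous_finsetSum _ fun i _ => continuous_const.mul ?_)
      exact (continuous_multilinearExt _).comp (by fun_prop)
    · intro a ha
      rw [Finset.mul_sum]
      refine Finset.sum_le_sum fun i _ => ?_
      have h2 := multilinearExt_mono (hg i) (segment_mem_cube hx hxu ha)
      rw [multilinearExt_const] at h2
      simp only [add_sub_cancel_left]
      nlinarith [hu i, mul_le_mul_of_nonneg_left h2 (hu i)]
  linarith

/-- Second-order lower bound along nonnegative directions. -/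
theorem multilinearExt_add_ge {f : Finset (Fin d) → ℝ} {K : ℝ}
    (hf : ∀ i j S, -K ≤ discreteDeriv i (discreteDeriv j f) S) {x u : Fin d → ℝ} (hu : 0 ≤ u)
    (hx : x ∈ Set.Icc (0 : Fin d → ℝ) 1) (hxu : x + u ∈ Set.Icc (0 : Fin d → ℝ) 1) :
    multilinearExt f x + ∑ i, u i * multilinearExt (discreteDeriv i f) x
      - K / 2 * (∑ i, u i) ^ 2 ≤ multilinearExt f (x + u) := by
  set σ := ∑ i, u i with hσ
  set G := ∑ i, u i * multilinearExt (discreteDeriv i f) x with hG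
  have h := integral_multilinearExt_segment f x (x + u)
  have h0 : ∫ a in Set.Icc (0 : ℝ) 1, (G - a * (K * σ ^ 2)) = G - K / 2 * σ ^ 2 := by
    rw [integral_Icc_eq_integral_Ioc, ← intervalIntegral.integral_of_le zero_le_one,
      intervalIntegral.integral_sub (by simp) (Continuous.intervalIntegrable (by fun_prop) _ _),
      intervalIntegral.integral_mul_const]
    simp
    ring
  have h1 : ∫ a in Set.Icc (0 : ℝ) 1, (G - a * (K * σ ^ 2)) ≤
      ∫ a in Set.Icc (0 : ℝ) 1, ∑ i, (x + u - x) i *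
        multilinearExt (discreteDeriv i f) (a • (x + u) + (1 - a) • x) := by
    refine setIntegral_mono_on (Continuous.integrableOn_Icc (by fun_prop)) ?_ measurableSet_Icc ?_
    · refine Continuous.integrableOn_Icc (continuous_finsetSum _ fun i _ => continuous_const.mul ?_)
      exact (continuous_multilinearExt _).comp (by fun_prop)
    · intro a ha
      have hm := segment_mem_cube hx hxu ha
      have he : a • (x + u) + (1 - a) • x = x + a • u := by ext j; simp; ring
      -- The first-order bound, applied to each partial derivative over the displacement a • u,
      -- limits its decrease to K a σ; integrating over a produces the factor 1/2.
      have key : ∀ i, u i * multilinearExt (discreteDeriv i f) x - u i * (a * (K * σ)) ≤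
          (x + u - x) i * multilinearExt (discreteDeriv i f) (a • (x + u) + (1 - a) • x) := by
        intro i
        rw [he] at hm ⊢
        have h2 := multilinearExt_sub_le_add (fun j => hf j i) (smul_nonneg ha.1 hu) hx hm
        simp only [Pi.smul_apply, smul_eq_mul, ← Finset.mul_sum, ← hσ] at h2
        simp only [add_sub_cancel_left]
        nlinarith [mul_le_mul_of_nonneg_left h2 (hu i)]
      have := Finset.sum_le_sum fun i (_ : i ∈ Finset.univ) => key i
      rw [Finset.sum_sub_distrib, ← Finset.sum_mul, ← hσ, ← hG] at this
      linarith
  linarith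

/-- Adding the elements of R to S one at a time, submodularity bounds each gain by the gain of
adding that element to S alone. `discreteDeriv` dominates that gain by monotonicity, since it
subtracts `f` at S without the element. -/
theorem le_add_sum_marginals {f : Finset (Fin d) → ℝ} (hmono : Monotone f) (hsub : IsSubmodular f)
    (R S : Finset (Fin d)) : f R ≤ f S + ∑ i ∈ R, discreteDeriv i f S := by
  suffices h : f (S ∪ R) ≤ f S + ∑ i ∈ R, discreteDeriv i f S from
    (hmono Finset.subset_union_right).trans h
  induction R using Finset.induction_on with
  | empty => simp
  | insert a R ha ih =>
    rw [Finset.sum_insert ha]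
    have h1 := hsub (S ∪ R) (insert a S)
    have h2 : (S ∪ R) ∪ insert a S = S ∪ insert a R := by ext; simp; tauto
    have h3 : f S ≤ f ((S ∪ R) ∩ insert a S) :=
      hmono (Finset.subset_inter Finset.subset_union_left (Finset.subset_insert _ _))
    have h4 : f (S.erase a) ≤ f S := hmono (Finset.erase_subset _ _)
    rw [h2] at h1
    simp only [discreteDeriv] at ih ⊢
    linarith

/-- The set inequality `le_add_sum_marginals` is averaged over independent random sets, first R with
marginals y, then S with marginals x; membership of i in R has mean y_i. -/
theorem multilinearExt_sub_le_inner {f : Finset (Fin d) → ℝ} (hmono : Monotone f)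
    (hsub : IsSubmodular f) {x y : Fin d → ℝ} (hx : x ∈ Set.Icc (0 : Fin d → ℝ) 1)
    (hy : y ∈ Set.Icc (0 : Fin d → ℝ) 1) :
    multilinearExt f y - multilinearExt f x ≤
      ∑ i, y i * multilinearExt (discreteDeriv i f) x := by
  have h1 : ∀ S, multilinearExt f y ≤ f S + ∑ i, y i * discreteDeriv i f S := by
    intro S
    have h2 : ∀ R, f R ≤ f S + ∑ i, (if i ∈ R then 1 else 0) * discreteDeriv i f S := by
      intro R
      simpa using le_add_sum_marginals hmono hsub R S
    refine (multilinearExt_mono h2 hy).trans (le_of_eq ?_)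
    rw [multilinearExt_add, multilinearExt_const, multilinearExt_sum]
    simp only [multilinearExt_mul_const, multilinearExt_indicator_mem]
  have h3 := multilinearExt_mono h1 hx
  rw [multilinearExt_const, multilinearExt_add, multilinearExt_sum] at h3
  simp only [mul_comm (y _), multilinearExt_mul_const] at h3 ⊢
  linarith

end SetFunctions

/-! ### Cube, coordinate-sum and diameter bounds for the matroid polytope -/

section MatroidPolytope

variable {d : ℕ} {𝓘 : Matroid (Fin d)} {r : ℕ}

theorem rank_le_card (hrank : 𝓘.eRank = (r : ℕ∞)) : r ≤ d := by
  have h := 𝓘.eRank_le_encard_ground.trans (Set.encard_le_encard (Set.subset_univ 𝓘.E))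
  rw [hrank, Set.encard_univ, ENat.card_eq_coe_fintype_card, Fintype.card_fin] at h
  exact_mod_cast h

theorem matroidPolytope_subset (hrank : 𝓘.eRank = (r : ℕ∞)) :
    matroidPolytope 𝓘 ⊆ Set.Icc (0 : Fin d → ℝ) 1 ∩ {x | ∑ i, x i ≤ r} := by
  classical
  refine convexHull_min ?_ ((convex_Icc _ _).inter ?_)
  · rintro _ ⟨I, hI, rfl⟩
    refine ⟨⟨fun i => ?_, fun i => ?_⟩, ?_⟩
    · by_cases h : i ∈ I <;> simp [h]
    · by_cases h : i ∈ I <;> simp [h]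
    · have h := hI.encard_le_eRank
      rw [hrank, Set.encard_eq_coe_toFinset_card] at h
      have h' : I.toFinset.card ≤ r := by exact_mod_cast h
      have : ∑ i, Set.indicator I (1 : Fin d → ℝ) i = I.toFinset.card := by
        simp [Set.indicator_apply, Set.toFinset_card, Fintype.card_subtype]
      simpa [this] using h'
  · exact convex_halfSpace_le ⟨fun x y => by simp [Finset.sum_add_distrib],
      fun c x => by simp [Finset.mul_sum]⟩ _

/-- For a, b in [0, 1] one has (a - b)² ≤ a + b, and each coordinate sum is at most r. -/
theorem sum_sq_sub_le (hrank : 𝓘.eRank = (r : ℕ∞)) {v w : Fin d → ℝ}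
    (hv : v ∈ matroidPolytope 𝓘) (hw : w ∈ matroidPolytope 𝓘) :
    ∑ i, (v i - w i) ^ 2 ≤ 2 * r := by
  obtain ⟨hv1, hv2⟩ := matroidPolytope_subset hrank hv
  obtain ⟨hw1, hw2⟩ := matroidPolytope_subset hrank hw
  have h : ∑ i, (v i - w i) ^ 2 ≤ ∑ i, (v i + w i) := by
    refine Finset.sum_le_sum fun i _ => ?_
    have h1 : 0 ≤ v i := hv1.1 i
    have h2 : v i ≤ 1 := hv1.2 i
    have h3 : 0 ≤ w i := hw1.1 i
    have h4 : w i ≤ 1 := hw1.2 i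
    nlinarith [mul_nonneg h1 h3, mul_nonneg h1 (sub_nonneg.2 h2), mul_nonneg h3 (sub_nonneg.2 h4)]
  rw [Finset.sum_add_distrib] at h
  simp only [Set.mem_ofPred_eq] at hv2 hw2
  linarith

end MatroidPolytope

/-! ### Discrete derivatives and the largest marginal -/

section DiscreteDerivatives

variable {d : ℕ}

theorem discreteDeriv_comm (i j : Fin d) (f : Finset (Fin d) → ℝ) :
    discreteDeriv i (discreteDeriv j f) = discreteDeriv j (discreteDeriv i f) := by
  ext S
  by_cases hij : i = j
  · rw [hij]
  · simp only [discreteDeriv, Finset.insert_comm j i, Finset.erase_right_comm (a := i) (b := j),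
      Finset.erase_insert_of_ne hij, Finset.erase_insert_of_ne (Ne.symm hij)]
    ring

theorem abs_discreteDeriv_le_maxMarginal (i : Fin d) (f : Finset (Fin d) → ℝ)
    (S : Finset (Fin d)) : |discreteDeriv i f S| ≤ maxMarginal f := by
  have h := le_ciSup (f := fun p : Finset (Fin d) × Fin d => |f (insert p.2 p.1) - f p.1|)
    (Set.finite_range _).bddAbove (S.erase i, i)
  have hins : insert i (S.erase i) = insert i S := by
    ext j; by_cases hj : j = i <;> simp [hj]
  dsimp only at h
  rwa [hins] at h

theorem abs_discreteDeriv_discreteDeriv_le (i j : Fin d) (f : Finset (Fin d) → ℝ)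
    (S : Finset (Fin d)) : |discreteDeriv i (discreteDeriv j f) S| ≤ 2 * maxMarginal f := by
  have h1 := abs_discreteDeriv_le_maxMarginal j f (insert i S)
  have h2 := abs_discreteDeriv_le_maxMarginal j f (S.erase i)
  have h3 := abs_sub (discreteDeriv j f (insert i S)) (discreteDeriv j f (S.erase i))
  rw [discreteDeriv]
  linarith

theorem maxMarginal_nonneg (f : Finset (Fin d) → ℝ) : 0 ≤ maxMarginal f :=
  Real.iSup_nonneg fun _ => abs_nonneg _

theorem discreteDeriv_nonneg {f : Finset (Fin d) → ℝ} (hf : Monotone f) (i : Fin d)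
    (S : Finset (Fin d)) : 0 ≤ discreteDeriv i f S :=
  sub_nonneg.2 (hf ((Finset.erase_subset _ _).trans (Finset.subset_insert _ _)))

end DiscreteDerivatives

/-! ### Marginals of the mean set function -/

section StochasticSetFunction

variable {d : ℕ} {Γ : Type*} [MeasurableSpace Γ] {μ : Measure Γ} {fγ : Γ → Finset (Fin d) → ℝ}

theorem measurable_maxMarginal (hf : ∀ S, Measurable fun γ => fγ γ S) :
    Measurable fun γ => maxMarginal (fγ γ) :=
  Measurable.iSup fun p => continuous_abs.measurable.comp ((hf (insert p.2 p.1)).sub (hf p.1))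

theorem meanSetFn_discreteDeriv (hint : ∀ S, Integrable (fun γ => fγ γ S) μ) (i : Fin d) :
    meanSetFn μ (fun γ => discreteDeriv i (fγ γ)) = discreteDeriv i (meanSetFn μ fγ) :=
  funext fun _ => integral_sub (hint _) (hint _)

theorem integrable_discreteDeriv (hint : ∀ S, Integrable (fun γ => fγ γ S) μ) (i : Fin d)
    (S : Finset (Fin d)) : Integrable (fun γ => discreteDeriv i (fγ γ) S) μ :=
  (hint _).sub (hint _)

theorem HasBoundedMarginals.memLp {Df : ℝ} (h : HasBoundedMarginals μ fγ Df)
    (hf : ∀ S, Measurable fun γ => fγ γ S) : MemLp (fun γ => maxMarginal (fγ γ)) 2 μ :=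
  (memLp_two_iff_integrable_sq (measurable_maxMarginal hf).aestronglyMeasurable).2 h.2.1

/-- Nonnegativity of the variance turns the second moment bound into a first moment bound. -/
theorem HasBoundedMarginals.integral_maxMarginal_le [IsProbabilityMeasure μ] {Df : ℝ}
    (h : HasBoundedMarginals μ fγ Df) (hf : ∀ S, Measurable fun γ => fγ γ S) :
    ∫ γ, maxMarginal (fγ γ) ∂μ ≤ Df := by
  have h1 := variance_eq_sub (h.memLp hf)
  have h2 := variance_nonneg (fun γ => maxMarginal (fγ γ)) μ
  refine le_of_sq_le_sq ?_ h.1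
  have h3 := h.2.2
  simp only [Pi.pow_apply] at h1
  linarith

theorem discreteDeriv_meanSetFn_le [IsProbabilityMeasure μ]
    (hf : ∀ S, Measurable fun γ => fγ γ S) (hint : ∀ S, Integrable (fun γ => fγ γ S) μ) {Df : ℝ}
    (h : HasBoundedMarginals μ fγ Df) (i : Fin d) (S : Finset (Fin d)) :
    discreteDeriv i (meanSetFn μ fγ) S ≤ Df := by
  rw [← meanSetFn_discreteDeriv hint]
  refine le_trans ?_ (h.integral_maxMarginal_le hf)
  exact integral_mono (integrable_discreteDeriv hint i S) ((h.memLp hf).integrable one_le_two)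
    fun γ => (le_abs_self _).trans (abs_discreteDeriv_le_maxMarginal i (fγ γ) S)

/-- A second difference is a difference of two first derivatives of the mean, both lying in [0, Df].
This gives the constant Df rather than 2 Df. -/
theorem neg_le_discreteDeriv_discreteDeriv_meanSetFn [IsProbabilityMeasure μ]
    (hf : ∀ S, Measurable fun γ => fγ γ S) (hint : ∀ S, Integrable (fun γ => fγ γ S) μ) {Df : ℝ}
    (h : HasBoundedMarginals μ fγ Df) (hmono : Monotone (meanSetFn μ fγ)) (i j : Fin d)
    (S : Finset (Fin d)) : -Df ≤ discreteDeriv i (discreteDeriv j (meanSetFn μ fγ)) S := by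
  have h1 := discreteDeriv_nonneg hmono j (insert i S)
  have h2 := discreteDeriv_meanSetFn_le hf hint h j (S.erase i)
  rw [discreteDeriv]
  linarith

end StochasticSetFunction

/-! ### Expectations under the sampling laws and unbiasedness -/

section Sampling

variable {d : ℕ} {Γ : Type*} [MeasurableSpace Γ] {μ : Measure Γ} {fγ : Γ → Finset (Fin d) → ℝ}

/-- `N(z)` identifies `{0, 1}^d` with the subsets of the ground set. -/
def suppEquiv (d : ℕ) : (Fin d → Bool) ≃ Finset (Fin d) where
  toFun := supp
  invFun S i := decide (i ∈ S)
  left_inv z := by ext i; simp [supp]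
  right_inv S := by ext i; simp [supp]

theorem pi_bernoulli_real_singleton {x : Fin d → ℝ} (hx : x ∈ Set.Icc (0 : Fin d → ℝ) 1)
    (z : Fin d → Bool) :
    (Measure.pi fun i => (bernoulliMeasure true false
      (Set.projIcc (0 : ℝ) 1 zero_le_one (x i)) : Measure Bool)).real {z} =
      (∏ i ∈ supp z, x i) * ∏ i ∈ (supp z)ᶜ, (1 - x i) := by
  have h : ∀ i, (bernoulliMeasure true false
      (Set.projIcc (0 : ℝ) 1 zero_le_one (x i)) : Measure Bool).real {z i} =
      if z i = true then x i else 1 - x i := by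
    intro i
    rw [bernoulliMeasure_real_apply _ (measurableSet_singleton _),
      Set.projIcc_of_mem zero_le_one ⟨hx.1 i, hx.2 i⟩]
    cases hz : z i <;> simp
  rw [Measure.real, Measure.pi_singleton, ENNReal.toReal_prod]
  have h' := fun i => h i
  simp only [Measure.real] at h'
  simp only [h', Finset.prod_ite, supp, Finset.compl_filter]

/-- There are finitely many z, each with probability equal to its multilinear weight, and γ is
independent of z. On the cube the clamping in `sampleLaw` is inactive. -/
theorem integrable_sampleLaw_and_integral_eq [IsProbabilityMeasure μ]
    {h : Γ → Finset (Fin d) → ℝ} (hint : ∀ S, Integrable (fun γ => h γ S) μ)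
    {x : Fin d → ℝ} (hx : x ∈ Set.Icc (0 : Fin d → ℝ) 1) :
    Integrable (fun ω => h ω.1 (supp ω.2)) (sampleLaw μ x) ∧
      ∫ ω, h ω.1 (supp ω.2) ∂(sampleLaw μ x) = multilinearExt (meanSetFn μ h) x := by
  set ν := Measure.pi fun i => (bernoulliMeasure true false
      (Set.projIcc (0 : ℝ) 1 zero_le_one (x i)) : Measure Bool)
  have e : (fun ω : Γ × (Fin d → Bool) => h ω.1 (supp ω.2)) =
      fun ω => ∑ z, h ω.1 (supp z) * Set.indicator {z} (1 : (Fin d → Bool) → ℝ) ω.2 := by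
    ext ω
    rw [Finset.sum_eq_single ω.2] <;> simp +contextual [eq_comm]
  have hi : ∀ z : Fin d → Bool, Integrable (fun ω : Γ × (Fin d → Bool) =>
      h ω.1 (supp z) * Set.indicator {z} (1 : (Fin d → Bool) → ℝ) ω.2) (μ.prod ν) := fun z =>
    (hint (supp z)).mul_prod ((integrable_const (1 : ℝ)).indicator (measurableSet_singleton z))
  rw [e, sampleLaw]
  refine ⟨integrable_finsetSum _ fun z _ => hi z, ?_⟩
  rw [integral_finsetSum _ fun z _ => hi z, multilinearExt, ← (suppEquiv d).sum_comp]
  refine Finset.sum_congr rfl fun z _ => ?_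
  rw [integral_prod_mul (fun γ => h γ (supp z)), integral_indicator_one (measurableSet_singleton z),
    pi_bernoulli_real_singleton hx]
  rfl

omit [MeasurableSpace Γ] in
-- On the diagonal the second difference vanishes identically, matching the prescribed zero entries.
theorem hessSample_eq (ω : Γ × (Fin d → Bool)) (i j : Fin d) :
    hessSample fγ ω i j = discreteDeriv i (discreteDeriv j (fγ ω.1)) (supp ω.2) := by
  by_cases hij : i = j
  · subst hij
    have hins : ∀ S : Finset (Fin d), insert i (S.erase i) = insert i S := fun S => by
      ext j; by_cases hj : j = i <;> simp [hj]
    simp [hessSample, discreteDeriv, hins]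
  · have h1 : supp ω.2 ∪ {i, j} = insert j (insert i (supp ω.2)) := by ext; simp; tauto
    have h2 : (supp ω.2 ∪ {i}) \ {j} = (insert i (supp ω.2)).erase j := by ext; simp; tauto
    have h3 : (supp ω.2 ∪ {j}) \ {i} = insert j ((supp ω.2).erase i) := by
      ext k; by_cases hk : k = j
      · subst hk; simp [Ne.symm hij]
      · simp [hk]; tauto
    have h4 : supp ω.2 \ {i, j} = ((supp ω.2).erase i).erase j := by ext; simp; tauto
    simp only [hessSample, Matrix.of_apply, if_neg hij, discreteDeriv, h1, h2, h3, h4]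
    ring

omit [MeasurableSpace Γ] in
theorem gradSample_eq (ω : Γ × (Fin d → Bool)) (i : Fin d) :
    gradSample fγ ω i = discreteDeriv i (fγ ω.1) (supp ω.2) := by
  have h1 : supp ω.2 ∪ {i} = insert i (supp ω.2) := by ext; simp
  simp [gradSample, discreteDeriv, h1, Finset.sdiff_singleton_eq_erase]

theorem hessSample_unbiased [IsProbabilityMeasure μ]
    (hint : ∀ S, Integrable (fun γ => fγ γ S) μ) {x : Fin d → ℝ}
    (hx : x ∈ Set.Icc (0 : Fin d → ℝ) 1) (i j : Fin d) :
    Integrable (fun ω => hessSample fγ ω i j) (sampleLaw μ x) ∧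
      ∫ ω, hessSample fγ ω i j ∂(sampleLaw μ x) =
        multilinearExt (discreteDeriv i (discreteDeriv j (meanSetFn μ fγ))) x := by
  simp only [hessSample_eq]
  rw [← meanSetFn_discreteDeriv hint, ← meanSetFn_discreteDeriv (integrable_discreteDeriv hint j)]
  exact integrable_sampleLaw_and_integral_eq
    (integrable_discreteDeriv (integrable_discreteDeriv hint j) i) hx

theorem gradSample_unbiased [IsProbabilityMeasure μ]
    (hint : ∀ S, Integrable (fun γ => fγ γ S) μ) {x : Fin d → ℝ}
    (hx : x ∈ Set.Icc (0 : Fin d → ℝ) 1) (i : Fin d) :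
    ∫ ω, gradSample fγ ω i ∂(sampleLaw μ x) =
        multilinearExt (discreteDeriv i (meanSetFn μ fγ)) x := by
  simp only [gradSample_eq]
  rw [← meanSetFn_discreteDeriv hint]
  exact (integrable_sampleLaw_and_integral_eq (integrable_discreteDeriv hint i) hx).2

theorem measurable_gradSample (hf : ∀ S, Measurable fun γ => fγ γ S) (i : Fin d) :
    Measurable fun ω => gradSample fγ ω i :=
  (measurable_eval_supp hf (· ∪ {i})).sub (measurable_eval_supp hf (· \ {i}))

theorem measurable_hessSample (hf : ∀ S, Measurable fun γ => fγ γ S) (i j : Fin d) :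
    Measurable fun ω => hessSample fγ ω i j := by
  simp only [hessSample_eq, discreteDeriv]
  exact (((measurable_eval_supp hf fun S => insert j (insert i S)).sub
    (measurable_eval_supp hf fun S => (insert i S).erase j))).sub
    ((measurable_eval_supp hf fun S => insert j (S.erase i)).sub
    (measurable_eval_supp hf fun S => (S.erase i).erase j))

theorem map_fst_sampleLaw (μ : Measure Γ) [IsProbabilityMeasure μ] (x : Fin d → ℝ) :
    (sampleLaw μ x).map Prod.fst = μ := by
  rw [sampleLaw, Measure.map_fst_prod]
  simp

theorem measurable_sampleLaw_segment (μ : Measure Γ) [IsProbabilityMeasure μ]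
    (x x' : Fin d → ℝ) : Measurable fun a : ℝ => sampleLaw μ (a • x' + (1 - a) • x) :=
  (measurable_sampleLaw μ).comp (by fun_prop)

/-- The marginal of γ does not depend on where z is sampled, so moment bounds through `maxMarginal`
are uniform along the trajectory. -/
theorem map_fst_segmentLaw (μ : Measure Γ) [IsProbabilityMeasure μ] (x x' : Fin d → ℝ) :
    (segmentLaw μ x x').map Prod.fst = μ := by
  ext s hs
  rw [Measure.map_apply measurable_fst hs, segmentLaw, Measure.bind_apply (measurable_fst hs)
    (measurable_sampleLaw_segment μ x x').aemeasurable]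
  simp_rw [← Measure.map_apply measurable_fst hs, map_fst_sampleLaw]
  simp

theorem integral_segmentLaw [IsProbabilityMeasure μ] {x x' : Fin d → ℝ}
    {h : Γ × (Fin d → Bool) → ℝ} (hint : Integrable h (segmentLaw μ x x')) :
    ∫ ω, h ω ∂(segmentLaw μ x x') =
      ∫ a in Set.Icc (0 : ℝ) 1, ∫ ω, h ω ∂(sampleLaw μ (a • x' + (1 - a) • x)) :=
  Kernel.integral_comp (κ := Kernel.const Unit (volume.restrict (Set.Icc (0 : ℝ) 1)))
    (η := ⟨_, measurable_sampleLaw_segment μ x x'⟩) (a := ()) hint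

end Sampling

/-! ### Bias and variance of a minibatch average -/

section Minibatch

/-- Second moment of a shifted minibatch average. -/
theorem integrable_and_integral_sq_minibatch_le {Ω : Type*} [MeasurableSpace Ω] {ν : Measure Ω}
    [IsProbabilityMeasure ν] {Y : Ω → ℝ} (hY : MemLp Y 2 ν) {M : ℕ} (hM : M ≠ 0) (b : ℝ) :
    Integrable (fun ω : Fin M → Ω => (b + (M : ℝ)⁻¹ * ∑ k, Y (ω k)) ^ 2)
      (Measure.pi fun _ => ν) ∧
    ∫ ω : Fin M → Ω, (b + (M : ℝ)⁻¹ * ∑ k, Y (ω k)) ^ 2 ∂(Measure.pi fun _ => ν) ≤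
      (b + ∫ ω, Y ω ∂ν) ^ 2 + (M : ℝ)⁻¹ * ∫ ω, Y ω ^ 2 ∂ν := by
  have hM' : (M : ℝ) ≠ 0 := Nat.cast_ne_zero.2 hM
  have hk : ∀ k : Fin M, MemLp (fun ω : Fin M → Ω => Y (ω k)) 2 (Measure.pi fun _ => ν) :=
    fun k => hY.comp_measurePreserving (measurePreserving_eval (fun _ : Fin M => ν) k)
  have hs : MemLp (fun ω : Fin M → Ω => (M : ℝ)⁻¹ * ∑ k, Y (ω k)) 2 (Measure.pi fun _ => ν) :=
    (memLp_finsetSum _ fun k _ => hk k).const_mul _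
  have hZ : MemLp (fun ω : Fin M → Ω => b + (M : ℝ)⁻¹ * ∑ k, Y (ω k)) 2
      (Measure.pi fun _ => ν) := (memLp_const b).add hs
  refine ⟨hZ.integrable_sq, ?_⟩
  have hmean : ∫ ω : Fin M → Ω, (b + (M : ℝ)⁻¹ * ∑ k, Y (ω k)) ∂(Measure.pi fun _ => ν) =
      b + ∫ ω, Y ω ∂ν := by
    rw [integral_add (integrable_const b) (hs.integrable one_le_two), integral_const_mul,
      integral_finsetSum _ fun k _ => (hk k).integrable one_le_two]
    have : ∀ k : Fin M, ∫ ω : Fin M → Ω, Y (ω k) ∂(Measure.pi fun _ => ν) = ∫ ω, Y ω ∂ν :=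
      fun k => integral_comp_eval (μ := fun _ : Fin M => ν) hY.aestronglyMeasurable
    simp [this, hM']
  -- Variances of the M independent copies add, and the scaling 1/M squared leaves a single 1/M.
  have hvar : Var[fun ω : Fin M → Ω => b + (M : ℝ)⁻¹ * ∑ k, Y (ω k); Measure.pi fun _ => ν] =
      (M : ℝ)⁻¹ * Var[Y; ν] := by
    rw [variance_const_add hs.aestronglyMeasurable, variance_const_mul]
    have h := variance_sum_pi (μ := fun _ : Fin M => ν) (X := fun _ => Y) fun _ => hY
    have e : (∑ k : Fin M, fun ω : Fin M → Ω => Y (ω k)) = fun ω => ∑ k, Y (ω k) := by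
      ext ω; simp
    rw [e] at h
    rw [h]
    simp
    field_simp
  have h1 := variance_eq_sub hZ
  rw [hvar, hmean] at h1
  have h2 : Var[Y; ν] ≤ ∫ ω, Y ω ^ 2 ∂ν := variance_le_expectation_sq hY.aestronglyMeasurable
  have h3 := mul_le_mul_of_nonneg_left h2 (inv_nonneg.2 (Nat.cast_nonneg (α := ℝ) M))
  simp only [Pi.pow_apply] at h1
  linarith

end Minibatch

/-! ### Expected squared gradient error: initialization and one round -/

section GradientError

variable {d : ℕ}

/-- The squared Euclidean error `‖g - ∇F(x)‖²` of the gradient estimate at the state `(x, g)`. -/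
noncomputable def gradError (f : Finset (Fin d) → ℝ) (s : (Fin d → ℝ) × (Fin d → ℝ)) : ℝ :=
  ∑ i, (s.2 i - multilinearExt (discreteDeriv i f) s.1) ^ 2

theorem gradError_nonneg (f : Finset (Fin d) → ℝ) (s : (Fin d → ℝ) × (Fin d → ℝ)) :
    0 ≤ gradError f s := Finset.sum_nonneg fun _ _ => sq_nonneg _

theorem measurable_gradError (f : Finset (Fin d) → ℝ) : Measurable (gradError f) := by
  refine Finset.measurable_sum _ fun i _ => Measurable.pow_const (Measurable.sub ?_ ?_) 2
  · fun_prop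
  · exact (continuous_multilinearExt _).measurable.comp measurable_fst

variable {Γ : Type*} [MeasurableSpace Γ] {μ : Measure Γ} [IsProbabilityMeasure μ]
  {fγ : Γ → Finset (Fin d) → ℝ} {Df : ℝ}

omit [IsProbabilityMeasure μ] in
/-- A sampling scheme whose first marginal is `μ` inherits second moment bounds in terms of the
largest marginal return. -/
theorem memLp_and_integral_sq_le (hf : ∀ S, Measurable fun γ => fγ γ S)
    (h : HasBoundedMarginals μ fγ Df) {ν : Measure (Γ × (Fin d → Bool))}
    (hν : ν.map Prod.fst = μ) {Y : Γ × (Fin d → Bool) → ℝ} (hY : Measurable Y) {c : ℝ}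
    (hYc : ∀ ω, |Y ω| ≤ c * maxMarginal (fγ ω.1)) :
    MemLp Y 2 ν ∧ ∫ ω, Y ω ^ 2 ∂ν ≤ c ^ 2 * Df ^ 2 := by
  have hG : MemLp (fun ω : Γ × (Fin d → Bool) => maxMarginal (fγ ω.1)) 2 ν :=
    (h.memLp hf).comp_measurePreserving ⟨measurable_fst, hν⟩
  have hL : MemLp Y 2 ν := by
    refine (hG.const_mul c).of_le hY.aestronglyMeasurable (Filter.Eventually.of_forall fun ω => ?_)
    exact (hYc ω).trans (le_abs_self _)
  refine ⟨hL, ?_⟩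
  have hsq : ∫ ω, maxMarginal (fγ ω.1) ^ 2 ∂ν = ∫ γ, maxMarginal (fγ γ) ^ 2 ∂μ := by
    rw [← hν, integral_map measurable_fst.aemeasurable]
    exact ((measurable_maxMarginal hf).pow_const 2).aestronglyMeasurable
  calc ∫ ω, Y ω ^ 2 ∂ν ≤ ∫ ω, c ^ 2 * maxMarginal (fγ ω.1) ^ 2 ∂ν := by
        refine integral_mono hL.integrable_sq (hG.integrable_sq.const_mul _) fun ω => ?_
        rw [← mul_pow]
        exact sq_le_sq' (by linarith [abs_le.1 (hYc ω)]) (abs_le.1 (hYc ω)).2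
    _ = c ^ 2 * ∫ γ, maxMarginal (fγ γ) ^ 2 ∂μ := by rw [integral_const_mul, hsq]
    _ ≤ c ^ 2 * Df ^ 2 := mul_le_mul_of_nonneg_left h.2.2 (sq_nonneg c)

/-- Expected squared error of a vector-valued minibatch estimate. -/
theorem lintegral_minibatch_le {Ω : Type*} [MeasurableSpace Ω] {ν : Measure Ω}
    [IsProbabilityMeasure ν] {Y : Fin d → Ω → ℝ} (hY : ∀ i, MemLp (Y i) 2 ν) {M : ℕ} (hM : M ≠ 0)
    {b a : Fin d → ℝ} (hba : ∀ i, b i + ∫ ω, Y i ω ∂ν = a i) {V : ℝ}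
    (hV : ∀ i, ∫ ω, Y i ω ^ 2 ∂ν ≤ V) :
    ∫⁻ ω : Fin M → Ω, ENNReal.ofReal (∑ i, (b i + (M : ℝ)⁻¹ * ∑ k, Y i (ω k)) ^ 2)
      ∂(Measure.pi fun _ => ν) ≤ ENNReal.ofReal (∑ i, a i ^ 2 + d * ((M : ℝ)⁻¹ * V)) := by
  have h := fun i => integrable_and_integral_sq_minibatch_le (hY i) hM (b i)
  rw [← ofReal_integral_eq_lintegral_ofReal (integrable_finsetSum _ fun i _ => (h i).1)
    (Filter.Eventually.of_forall fun ω => Finset.sum_nonneg fun i _ => sq_nonneg _),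
    integral_finsetSum _ fun i _ => (h i).1]
  refine ENNReal.ofReal_le_ofReal ?_
  have hd : (d : ℝ) * ((M : ℝ)⁻¹ * V) = ∑ _i : Fin d, (M : ℝ)⁻¹ * V := by simp
  rw [hd, ← Finset.sum_add_distrib]
  refine Finset.sum_le_sum fun i _ => (h i).2.trans ?_
  rw [hba]
  have := mul_le_mul_of_nonneg_left (hV i) (inv_nonneg.2 (Nat.cast_nonneg (α := ℝ) M))
  linarith

theorem lintegral_gradError_init_le (hf : ∀ S, Measurable fun γ => fγ γ S)
    (hint : ∀ S, Integrable (fun γ => fγ γ S) μ) (h : HasBoundedMarginals μ fγ Df) (T M : ℕ)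
    {M₀ : ℕ} (hM₀ : M₀ ≠ 0) (lmo : (Fin d → ℝ) → (Fin d → ℝ)) :
    ∫⁻ s, ENNReal.ofReal (gradError (meanSetFn μ fγ) s) ∂(stateLaw μ fγ T M₀ M lmo 0) ≤
      ENNReal.ofReal (d * ((M₀ : ℝ)⁻¹ * Df ^ 2)) := by
  have hm := fun i => memLp_and_integral_sq_le hf h (map_fst_sampleLaw μ 0)
    (measurable_gradSample hf i) (c := 1) fun ω => by
      rw [gradSample_eq, one_mul]; exact abs_discreteDeriv_le_maxMarginal _ _ _
  have hb := lintegral_minibatch_le (fun i => (hm i).1) hM₀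
    -- The shift is minus the true gradient at 0, so unbiasedness makes the mean error `a` zero.
    (b := fun i => -multilinearExt (discreteDeriv i (meanSetFn μ fγ)) 0) (a := 0)
    (fun i => by rw [gradSample_unbiased hint ⟨le_rfl, zero_le_one⟩]; simp)
    (V := Df ^ 2) fun i => by simpa using (hm i).2
  rw [stateLaw, lintegral_map ((measurable_gradError _).ennreal_ofReal)
    (measurable_const.prodMk (measurable_gradBatch hf M₀))]
  refine le_trans (le_of_eq ?_) (hb.trans (le_of_eq (by simp)))
  refine lintegral_congr fun ω => ?_
  simp only [gradError, gradBatch, Pi.smul_apply, Finset.sum_apply, smul_eq_mul]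
  congr 1
  exact Finset.sum_congr rfl fun i _ => by ring

theorem measurable_stepMap (hf : ∀ S, Measurable fun γ => fγ γ S) (T M : ℕ)
    (lmo : (Fin d → ℝ) → (Fin d → ℝ)) (s : (Fin d → ℝ) × (Fin d → ℝ)) :
    Measurable fun ω : Fin M → Γ × (Fin d → Bool) =>
      (nextPoint T lmo s, s.2 + (hessBatch fγ ω).mulVec (nextPoint T lmo s - s.1)) := by
  refine measurable_const.prodMk (measurable_const.add (measurable_pi_lambda _ fun i => ?_))
  simp only [Matrix.mulVec, dotProduct]
  exact Finset.measurable_sum _ fun j _ => (measurable_hessBatch hf M i j).mul_const _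

theorem lintegral_gradError_step_le (hf : ∀ S, Measurable fun γ => fγ γ S)
    (hint : ∀ S, Integrable (fun γ => fγ γ S) μ) (h : HasBoundedMarginals μ fγ Df) {T M : ℕ}
    (hM : M ≠ 0) {lmo : (Fin d → ℝ) → (Fin d → ℝ)} {s : (Fin d → ℝ) × (Fin d → ℝ)}
    (hs : s.1 ∈ Set.Icc (0 : Fin d → ℝ) 1)
    (hs' : nextPoint T lmo s ∈ Set.Icc (0 : Fin d → ℝ) 1) {σ : ℝ}
    (hσ : ∑ i, |(nextPoint T lmo s - s.1) i| ≤ σ) :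
    ∫⁻ s', ENNReal.ofReal (gradError (meanSetFn μ fγ) s') ∂(stepLaw μ fγ T M lmo s) ≤
      ENNReal.ofReal (gradError (meanSetFn μ fγ) s + d * ((M : ℝ)⁻¹ * ((2 * σ) ^ 2 * Df ^ 2))) := by
  set x := s.1 with hx
  set x' := nextPoint T lmo s with hx'
  set F := meanSetFn μ fγ with hF
  -- Coordinate i of the increment H(x' - x) from a single sample.
  let Y : Fin d → Γ × (Fin d → Bool) → ℝ := fun i ω => ∑ j, hessSample fγ ω i j * (x' - x) j
  have hYm : ∀ i, Measurable (Y i) := fun i =>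
    Finset.measurable_sum _ fun j _ => (measurable_hessSample hf i j).mul_const _
  have hYb : ∀ i ω, |Y i ω| ≤ (2 * σ) * maxMarginal (fγ ω.1) := by
    intro i ω
    calc |Y i ω| ≤ ∑ j, |hessSample fγ ω i j * (x' - x) j| := Finset.abs_sum_le_sum_abs _ _
      _ ≤ ∑ j, 2 * maxMarginal (fγ ω.1) * |(x' - x) j| := by
          refine Finset.sum_le_sum fun j _ => ?_
          rw [abs_mul, hessSample_eq]
          exact mul_le_mul_of_nonneg_right (abs_discreteDeriv_discreteDeriv_le i j _ _)
            (abs_nonneg _)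
      _ ≤ (2 * σ) * maxMarginal (fγ ω.1) := by
          rw [← Finset.mul_sum]
          nlinarith [mul_le_mul_of_nonneg_left hσ (maxMarginal_nonneg (fγ ω.1))]
  have hm := fun i => memLp_and_integral_sq_le hf h (map_fst_segmentLaw μ x x') (hYm i) (hYb i)
  -- Averaging over the uniform parameter integrates the Hessian along the segment; symmetry of
  -- second differences turns row i into the gradient of the i-th partial derivative.
  have hmean : ∀ i, ∫ ω, Y i ω ∂(segmentLaw μ x x') =
      multilinearExt (discreteDeriv i F) x' - multilinearExt (discreteDeriv i F) x := by
    intro i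
    rw [integral_segmentLaw ((hm i).1.integrable one_le_two), ← integral_multilinearExt_segment]
    refine setIntegral_congr_fun measurableSet_Icc fun a ha => ?_
    have hu := fun j => hessSample_unbiased hint (segment_mem_cube hs hs' ha) i j
    simp only [Y]
    rw [integral_finsetSum _ fun j _ => (hu j).1.mul_const _]
    refine Finset.sum_congr rfl fun j _ => ?_
    rw [integral_mul_const, (hu j).2, discreteDeriv_comm i j, mul_comm]
  have hb := lintegral_minibatch_le (fun i => (hm i).1) hM
    -- The shift uses the gradient at the new point. Adding the mean increment turns it into the old
    -- error, so no bias accumulates.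
    (b := fun i => s.2 i - multilinearExt (discreteDeriv i F) x')
    (a := fun i => s.2 i - multilinearExt (discreteDeriv i F) x)
    (fun i => by rw [hmean]; ring) fun i => (hm i).2
  rw [stepLaw, lintegral_map ((measurable_gradError _).ennreal_ofReal)
    (measurable_stepMap hf T M lmo s)]
  refine le_trans (le_of_eq ?_) hb
  refine lintegral_congr fun ω => ?_
  simp only [gradError]
  congr 1
  refine Finset.sum_congr rfl fun i _ => ?_
  have hmul : (hessBatch fγ ω).mulVec (x' - x) i = (M : ℝ)⁻¹ * ∑ k, Y i (ω k) := by
    simp only [Matrix.mulVec, dotProduct, hessBatch, Matrix.smul_apply, Matrix.sum_apply, Y,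
      smul_eq_mul]
    rw [Finset.sum_comm, Finset.mul_sum]
    refine Finset.sum_congr rfl fun j _ => ?_
    rw [mul_assoc, Finset.sum_mul]
  rw [Pi.add_apply, hmul]
  ring

end GradientError

/-! ### The Markov chain of states: invariants and accumulated error -/

section Chain

variable {d : ℕ} {Γ : Type*} [MeasurableSpace Γ] {μ : Measure Γ} [IsProbabilityMeasure μ]
  {fγ : Γ → Finset (Fin d) → ℝ} {lmo : (Fin d → ℝ) → (Fin d → ℝ)}

theorem isProbabilityMeasure_stepLaw (hf : ∀ S, Measurable fun γ => fγ γ S) (T M : ℕ)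
    (s : (Fin d → ℝ) × (Fin d → ℝ)) : IsProbabilityMeasure (stepLaw μ fγ T M lmo s) :=
  Measure.isProbabilityMeasure_map (measurable_stepMap hf T M lmo s).aemeasurable

theorem isProbabilityMeasure_stateLaw (hf : ∀ S, Measurable fun γ => fγ γ S)
    (hl : Measurable lmo) (T M₀ M t : ℕ) :
    IsProbabilityMeasure (stateLaw μ fγ T M₀ M lmo t) := by
  induction t with
  | zero =>
    exact Measure.isProbabilityMeasure_map
      (measurable_const.prodMk (measurable_gradBatch hf M₀)).aemeasurable
  | succ t ih =>
    have := isProbabilityMeasure_stepLaw (μ := μ) (lmo := lmo) hf T M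
    refine ⟨?_⟩
    rw [stateLaw, Measure.bind_apply MeasurableSet.univ (measurable_stepLaw μ hf T M hl).aemeasurable]
    simp

/-- The law of the iterate is the first marginal of the law of the state. -/
theorem map_fst_stateLaw (hf : ∀ S, Measurable fun γ => fγ γ S)
    (hl : Measurable lmo) (T M₀ M t : ℕ) :
    (stateLaw μ fγ T M₀ M lmo t).map Prod.fst = iterateLaw μ fγ T M₀ M lmo t := by
  cases t with
  | zero =>
    rw [stateLaw, Measure.map_map measurable_fst
      (measurable_const.prodMk (measurable_gradBatch hf M₀)), iterateLaw]
    simp [Function.comp_def, Measure.map_const]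
  | succ t =>
    have hn := measurable_nextPoint T hl
    ext A hA
    rw [Measure.map_apply measurable_fst hA, stateLaw, iterateLaw,
      Measure.bind_apply (measurable_fst hA) (measurable_stepLaw μ hf T M hl).aemeasurable,
      Measure.map_apply hn hA, ← lintegral_indicator_one (hn hA)]
    refine lintegral_congr fun s => ?_
    rw [stepLaw, Measure.map_apply (measurable_stepMap hf T M lmo s) (measurable_fst hA)]
    -- The new point is determined by the state, not by the minibatch, so its conditional law is a
    -- point mass.
    by_cases hs : nextPoint T lmo s ∈ A <;> simp [hs, Set.preimage]

variable {𝓘 : Matroid (Fin d)} {r : ℕ}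

theorem nextPoint_mem {T : ℕ} (hrank : 𝓘.eRank = (r : ℕ∞))
    (hlmo : IsArgmaxOracle (matroidPolytope 𝓘) lmo) {t : ℝ}
    {s : (Fin d → ℝ) × (Fin d → ℝ)} (hs : s.1 ∈ Set.Icc (0 : Fin d → ℝ) fun _ => t / T) :
    nextPoint T lmo s ∈ Set.Icc (0 : Fin d → ℝ) fun _ => (t + 1) / T := by
  have hv := (matroidPolytope_subset hrank (hlmo s.2).1).1
  have hT : 0 ≤ 1 / (T : ℝ) := by positivity
  refine ⟨fun i => ?_, fun i => ?_⟩
  · exact add_nonneg (hs.1 i) (mul_nonneg hT (hv.1 i))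
  · have h1 : s.1 i ≤ t / T := hs.2 i
    have h2 : 1 / (T : ℝ) * lmo s.2 i ≤ 1 / T * 1 := mul_le_mul_of_nonneg_left (hv.2 i) hT
    simp only [nextPoint, Pi.add_apply, Pi.smul_apply, smul_eq_mul, add_div]
    linarith

/-- Each round adds at most 1/T to every coordinate. The box [0, t/T]^d is the invariant that keeps
all iterates up to time T in the cube. -/
theorem ae_iterateLaw_mem (hf : ∀ S, Measurable fun γ => fγ γ S) (hl : Measurable lmo)
    (hrank : 𝓘.eRank = (r : ℕ∞)) (hlmo : IsArgmaxOracle (matroidPolytope 𝓘) lmo)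
    (T M₀ M t : ℕ) :
    ∀ᵐ x ∂(iterateLaw μ fγ T M₀ M lmo t), x ∈ Set.Icc (0 : Fin d → ℝ) fun _ => (t : ℝ) / T := by
  induction t with
  | zero =>
    rw [iterateLaw, ae_dirac_iff (p := (· ∈ Set.Icc (0 : Fin d → ℝ) fun _ => ((0 : ℕ) : ℝ) / T))
      measurableSet_Icc]
    simp [Pi.le_def]
  | succ t ih =>
    rw [iterateLaw, ae_map_iff (p := (· ∈ Set.Icc (0 : Fin d → ℝ) fun _ => ((t + 1 : ℕ) : ℝ) / T))
      (measurable_nextPoint T hl).aemeasurable measurableSet_Icc]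
    rw [← map_fst_stateLaw hf hl,
      ae_map_iff (p := (· ∈ Set.Icc (0 : Fin d → ℝ) fun _ => (t : ℝ) / T))
      measurable_fst.aemeasurable measurableSet_Icc] at ih
    filter_upwards [ih] with s hs
    have := nextPoint_mem (T := T) hrank hlmo hs
    simpa using this

theorem ae_stateLaw_mem (hf : ∀ S, Measurable fun γ => fγ γ S) (hl : Measurable lmo)
    (hrank : 𝓘.eRank = (r : ℕ∞)) (hlmo : IsArgmaxOracle (matroidPolytope 𝓘) lmo)
    (T M₀ M t : ℕ) :
    ∀ᵐ s ∂(stateLaw μ fγ T M₀ M lmo t), s.1 ∈ Set.Icc (0 : Fin d → ℝ) fun _ => (t : ℝ) / T := by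
  have h := ae_iterateLaw_mem (μ := μ) hf hl hrank hlmo T M₀ M t
  rwa [← map_fst_stateLaw hf hl, ae_map_iff (p := (· ∈ Set.Icc (0 : Fin d → ℝ) fun _ => (t : ℝ) / T))
    measurable_fst.aemeasurable measurableSet_Icc] at h

theorem Icc_div_subset_cube {T : ℕ} (hT : T ≠ 0) {t : ℝ} (ht : t ≤ T) :
    (Set.Icc (0 : Fin d → ℝ) fun _ => t / T) ⊆ Set.Icc (0 : Fin d → ℝ) 1 :=
  Set.Icc_subset_Icc le_rfl fun _ =>
    (div_le_one (Nat.cast_pos.2 (Nat.pos_of_ne_zero hT))).2 ht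

theorem sum_abs_nextPoint_sub_le (T : ℕ) (hrank : 𝓘.eRank = (r : ℕ∞))
    (hlmo : IsArgmaxOracle (matroidPolytope 𝓘) lmo) (s : (Fin d → ℝ) × (Fin d → ℝ)) :
    ∑ i, |(nextPoint T lmo s - s.1) i| ≤ r / T := by
  obtain ⟨hv, hv'⟩ := matroidPolytope_subset hrank (hlmo s.2).1
  rw [Set.mem_ofPred_eq] at hv'
  have h : ∀ i, |(nextPoint T lmo s - s.1) i| = 1 / (T : ℝ) * lmo s.2 i := by
    intro i
    rw [nextPoint, add_sub_cancel_left, Pi.smul_apply, smul_eq_mul]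
    exact abs_of_nonneg (mul_nonneg (by positivity) (hv.1 i))
  simp only [h, ← Finset.mul_sum]
  rw [div_eq_mul_one_div (r : ℝ), mul_comm (r : ℝ)]
  exact mul_le_mul_of_nonneg_left hv' (by positivity)

theorem lintegral_gradError_stateLaw_le (hf : ∀ S, Measurable fun γ => fγ γ S)
    (hint : ∀ S, Integrable (fun γ => fγ γ S) μ) {Df : ℝ} (h : HasBoundedMarginals μ fγ Df)
    (hl : Measurable lmo) (hrank : 𝓘.eRank = (r : ℕ∞))
    (hlmo : IsArgmaxOracle (matroidPolytope 𝓘) lmo) {T M₀ M : ℕ} (hM₀ : M₀ ≠ 0)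
    (hM : M ≠ 0) {t : ℕ} (ht : t < T) :
    ∫⁻ s, ENNReal.ofReal (gradError (meanSetFn μ fγ) s) ∂(stateLaw μ fγ T M₀ M lmo t) ≤
      ENNReal.ofReal (d * ((M₀ : ℝ)⁻¹ * Df ^ 2) +
        t * (d * ((M : ℝ)⁻¹ * ((2 * (r / T)) ^ 2 * Df ^ 2)))) := by
  induction t with
  | zero => simpa using lintegral_gradError_init_le hf hint h T M hM₀ lmo
  | succ t ih =>
    have ih := ih (by omega)
    have hT : T ≠ 0 := by omega
    have := isProbabilityMeasure_stateLaw (μ := μ) hf hl T M₀ M t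
    set V := (d : ℝ) * ((M : ℝ)⁻¹ * ((2 * (r / T)) ^ 2 * Df ^ 2)) with hV
    have hV0 : 0 ≤ V := by positivity
    rw [stateLaw, Measure.lintegral_bind (measurable_stepLaw μ hf T M hl).aemeasurable
      (measurable_gradError _).ennreal_ofReal.aemeasurable]
    calc _ ≤ ∫⁻ s, ENNReal.ofReal (gradError (meanSetFn μ fγ) s) + ENNReal.ofReal V
          ∂(stateLaw μ fγ T M₀ M lmo t) := by
          refine lintegral_mono_ae ?_
          filter_upwards [ae_stateLaw_mem hf hl hrank hlmo T M₀ M t] with s hs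
          rw [← ENNReal.ofReal_add (gradError_nonneg _ s) hV0]
          exact lintegral_gradError_step_le hf hint h hM
            (Icc_div_subset_cube hT (by exact_mod_cast (by omega : t ≤ T)) hs)
            (Icc_div_subset_cube hT (by exact_mod_cast ht.le) (nextPoint_mem hrank hlmo hs))
            (sum_abs_nextPoint_sub_le T hrank hlmo s)
      _ = (∫⁻ s, ENNReal.ofReal (gradError (meanSetFn μ fγ) s) ∂(stateLaw μ fγ T M₀ M lmo t))
          + ENNReal.ofReal V := by
          rw [lintegral_add_right _ measurable_const]
          simp
      _ ≤ _ := by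
          refine (add_le_add_left ih _).trans (le_of_eq ?_)
          rw [← ENNReal.ofReal_add (by positivity) hV0]
          congr 1
          push_cast
          ring

end Chain

/-! ### Deterministic progress of one round -/

section Progress

variable {d : ℕ} {lmo : (Fin d → ℝ) → (Fin d → ℝ)} {𝓘 : Matroid (Fin d)} {r : ℕ}

/-- One step of the algorithm, with the gradient error split off by Young's inequality. -/
theorem multilinearExt_nextPoint_ge {f : Finset (Fin d) → ℝ} (hmono : Monotone f)
    (hsub : IsSubmodular f) {K : ℝ}
    (hK : ∀ i j S, -K ≤ discreteDeriv i (discreteDeriv j f) S) (hK0 : 0 ≤ K)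
    (hrank : 𝓘.eRank = (r : ℕ∞)) (hlmo : IsArgmaxOracle (matroidPolytope 𝓘) lmo)
    {y : Fin d → ℝ} (hy : y ∈ matroidPolytope 𝓘) {T : ℕ} {s : (Fin d → ℝ) × (Fin d → ℝ)}
    (hs : s.1 ∈ Set.Icc (0 : Fin d → ℝ) 1)
    (hs' : nextPoint T lmo s ∈ Set.Icc (0 : Fin d → ℝ) 1) {c : ℝ} (hc : 0 < c) :
    multilinearExt f s.1 + 1 / T * (multilinearExt f y - multilinearExt f s.1)
      - 1 / T * (c * r + gradError f s / (2 * c)) - K / 2 * (r / T) ^ 2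
      ≤ multilinearExt f (nextPoint T lmo s) := by
  set v := lmo s.2 with hv
  obtain ⟨hvC, hvr⟩ := matroidPolytope_subset hrank (hlmo s.2).1
  rw [Set.mem_ofPred_eq] at hvr
  have hT : 0 ≤ 1 / (T : ℝ) := by positivity
  have hcube := (matroidPolytope_subset hrank hy).1
  have h1 := multilinearExt_add_ge hK (smul_nonneg hT hvC.1) hs hs'
  simp only [Pi.smul_apply, smul_eq_mul, mul_assoc, ← Finset.mul_sum] at h1
  have h2 := multilinearExt_sub_le_inner hmono hsub hs hcube
  have h3 := (hlmo s.2).2 y hy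
  simp only [dotProduct] at h3
  -- Young's inequality with weights c/2 and 1/(2c); the bound ‖v - y‖² ≤ 2r turns the first part
  -- into c r.
  have h4 : ∑ i, (v i - y i) * (s.2 i - multilinearExt (discreteDeriv i f) s.1) ≤
      c * r + gradError f s / (2 * c) := by
    calc _ ≤ ∑ i, (c / 2 * (v i - y i) ^ 2 +
          (s.2 i - multilinearExt (discreteDeriv i f) s.1) ^ 2 / (2 * c)) := by
          refine Finset.sum_le_sum fun i _ => ?_
          set a := v i - y i
          set b := s.2 i - multilinearExt (discreteDeriv i f) s.1
          have : c / 2 * a ^ 2 + b ^ 2 / (2 * c) - a * b = (c * a - b) ^ 2 / (2 * c) := by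
            field_simp; ring
          have : 0 ≤ (c * a - b) ^ 2 / (2 * c) := by positivity
          linarith
      _ = c / 2 * ∑ i, (v i - y i) ^ 2 + gradError f s / (2 * c) := by
          rw [Finset.sum_add_distrib, ← Finset.mul_sum, ← Finset.sum_div, gradError]
      _ ≤ _ := by
          have := mul_le_mul_of_nonneg_left (sum_sq_sub_le hrank (hlmo s.2).1 hy) (half_pos hc).le
          rw [← hv] at this
          linarith
  -- The bracket is nonnegative because v maximizes against g; what remains compares v and y against
  -- the true gradient.
  have h5 : ∑ i, (v i - y i) * (s.2 i - multilinearExt (discreteDeriv i f) s.1) =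
      (∑ i, v i * s.2 i - ∑ i, y i * s.2 i) -
        ∑ i, v i * multilinearExt (discreteDeriv i f) s.1 +
        ∑ i, y i * multilinearExt (discreteDeriv i f) s.1 := by
    simp only [← Finset.sum_sub_distrib, ← Finset.sum_add_distrib]
    exact Finset.sum_congr rfl fun i _ => by ring
  have h6 : multilinearExt f y - multilinearExt f s.1 - (c * r + gradError f s / (2 * c)) ≤
      ∑ i, v i * multilinearExt (discreteDeriv i f) s.1 := by linarith
  have h7 := mul_le_mul_of_nonneg_left h6 hT
  have h8 : K / 2 * (1 / (T : ℝ) * ∑ i, v i) ^ 2 ≤ K / 2 * (r / T) ^ 2 := by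
    refine mul_le_mul_of_nonneg_left (pow_le_pow_left₀ ?_ ?_ 2) (by positivity)
    · exact mul_nonneg hT (Finset.sum_nonneg fun i _ => hvC.1 i)
    · rw [div_eq_mul_one_div (r : ℝ), mul_comm (r : ℝ)]
      exact mul_le_mul_of_nonneg_left hvr hT
  have h9 : multilinearExt f (nextPoint T lmo s) =
      multilinearExt f (s.1 + (1 / (T : ℝ)) • v) := rfl
  rw [h9]
  linarith

end Progress

/-! ### Expected progress and unrolling of the recurrence -/

section Guarantee

variable {d : ℕ} {Γ : Type*} [MeasurableSpace Γ] {μ : Measure Γ} [IsProbabilityMeasure μ]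
  {fγ : Γ → Finset (Fin d) → ℝ} {lmo : (Fin d → ℝ) → (Fin d → ℝ)}
  {𝓘 : Matroid (Fin d)} {r : ℕ}

theorem integrable_of_continuous_of_ae_mem_compact {E : Type*} [TopologicalSpace E]
    [MeasurableSpace E] [BorelSpace E] {ν : Measure E} [IsFiniteMeasure ν] {F : E → ℝ}
    (hF : Continuous F) {C : Set E} (hC : IsCompact C) (h : ∀ᵐ x ∂ν, x ∈ C) :
    Integrable F ν := by
  obtain ⟨b, hb⟩ := hC.exists_bound_of_continuousOn hF.continuousOn
  exact Integrable.of_bound hF.measurable.aestronglyMeasurable b (h.mono fun x hx => hb x hx)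

theorem isProbabilityMeasure_iterateLaw (hf : ∀ S, Measurable fun γ => fγ γ S)
    (hl : Measurable lmo) (T M₀ M t : ℕ) :
    IsProbabilityMeasure (iterateLaw μ fγ T M₀ M lmo t) := by
  have := isProbabilityMeasure_stateLaw (μ := μ) hf hl T M₀ M t
  rw [← map_fst_stateLaw hf hl]
  exact Measure.isProbabilityMeasure_map measurable_fst.aemeasurable

theorem integrable_multilinearExt_iterateLaw (hf : ∀ S, Measurable fun γ => fγ γ S)
    (hl : Measurable lmo) (hrank : 𝓘.eRank = (r : ℕ∞))
    (hlmo : IsArgmaxOracle (matroidPolytope 𝓘) lmo) (f : Finset (Fin d) → ℝ) (T M₀ M t : ℕ) :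
    Integrable (multilinearExt f) (iterateLaw μ fγ T M₀ M lmo t) := by
  have := isProbabilityMeasure_iterateLaw (μ := μ) hf hl T M₀ M t
  exact integrable_of_continuous_of_ae_mem_compact (continuous_multilinearExt f) isCompact_Icc
    (ae_iterateLaw_mem hf hl hrank hlmo T M₀ M t)

/-- Expected progress of one round. -/
theorem integral_iterateLaw_succ_ge (hf : ∀ S, Measurable fun γ => fγ γ S)
    (hint : ∀ S, Integrable (fun γ => fγ γ S) μ) (hmono : Monotone (meanSetFn μ fγ))
    (hsub : IsSubmodular (meanSetFn μ fγ)) {Df : ℝ} (h : HasBoundedMarginals μ fγ Df)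
    (hl : Measurable lmo) (hrank : 𝓘.eRank = (r : ℕ∞))
    (hlmo : IsArgmaxOracle (matroidPolytope 𝓘) lmo) {y : Fin d → ℝ}
    (hy : y ∈ matroidPolytope 𝓘) {T M₀ M t : ℕ} (ht : t < T) {B : ℝ} (hB : 0 ≤ B)
    (herr : ∫⁻ s, ENNReal.ofReal (gradError (meanSetFn μ fγ) s) ∂(stateLaw μ fγ T M₀ M lmo t) ≤
      ENNReal.ofReal B) {c : ℝ} (hc : 0 < c) :
    (1 - 1 / T) * ∫ x, multilinearExt (meanSetFn μ fγ) x ∂(iterateLaw μ fγ T M₀ M lmo t)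
      + 1 / T * multilinearExt (meanSetFn μ fγ) y
      - (1 / T * (c * r + B / (2 * c)) + Df / 2 * (r / T) ^ 2)
      ≤ ∫ x, multilinearExt (meanSetFn μ fγ) x ∂(iterateLaw μ fγ T M₀ M lmo (t + 1)) := by
  set F := meanSetFn μ fγ with hF
  set ν := stateLaw μ fγ T M₀ M lmo t with hν
  have : IsProbabilityMeasure ν := isProbabilityMeasure_stateLaw hf hl T M₀ M t
  have hT : T ≠ 0 := by omega
  have hcont := continuous_multilinearExt F
  have hn := measurable_nextPoint T hl
  have hi0 : Integrable (fun s : (Fin d → ℝ) × (Fin d → ℝ) => multilinearExt F s.1) ν := by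
    have := integrable_multilinearExt_iterateLaw (μ := μ) hf hl hrank hlmo F T M₀ M t
    rw [← map_fst_stateLaw hf hl] at this
    exact this.comp_measurable measurable_fst
  have hi1 : Integrable (fun s => multilinearExt F (nextPoint T lmo s)) ν :=
    (integrable_multilinearExt_iterateLaw (μ := μ) hf hl hrank hlmo F T M₀ M (t + 1)).comp_measurable
      hn
  have herr0 : 0 ≤ᵐ[ν] gradError F := Filter.Eventually.of_forall (gradError_nonneg F)
  -- Integrability of the error is a consequence of the finite bound on its lower integral.
  have hie : Integrable (gradError F) ν :=
    (lintegral_ofReal_ne_top_iff_integrable (measurable_gradError F).aestronglyMeasurable herr0).1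
      (ne_top_of_le_ne_top ENNReal.ofReal_ne_top herr)
  have hEB : ∫ s, gradError F s ∂ν ≤ B := by
    rw [integral_eq_lintegral_of_nonneg_ae herr0 (measurable_gradError F).aestronglyMeasurable]
    exact ENNReal.toReal_le_of_le_ofReal hB herr
  have e0 : ∫ x, multilinearExt F x ∂(iterateLaw μ fγ T M₀ M lmo t) =
      ∫ s, multilinearExt F s.1 ∂ν := by
    rw [← map_fst_stateLaw hf hl,
      integral_map measurable_fst.aemeasurable hcont.measurable.aestronglyMeasurable]
  have e1 : ∫ x, multilinearExt F x ∂(iterateLaw μ fγ T M₀ M lmo (t + 1)) =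
      ∫ s, multilinearExt F (nextPoint T lmo s) ∂ν := by
    rw [iterateLaw, integral_map hn.aemeasurable hcont.measurable.aestronglyMeasurable]
  have hle : ∀ᵐ s ∂ν, ((1 - 1 / T) * multilinearExt F s.1 - 1 / T / (2 * c) * gradError F s)
      + (1 / T * multilinearExt F y - 1 / T * (c * r) - Df / 2 * (r / T) ^ 2) ≤
      multilinearExt F (nextPoint T lmo s) := by
    filter_upwards [ae_stateLaw_mem hf hl hrank hlmo T M₀ M t] with s hs
    refine le_trans (le_of_eq ?_) (multilinearExt_nextPoint_ge hmono hsub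
      (neg_le_discreteDeriv_discreteDeriv_meanSetFn hf hint h hmono) h.1 hrank hlmo hy
      (Icc_div_subset_cube hT (by exact_mod_cast ht.le) hs)
      (Icc_div_subset_cube hT (by exact_mod_cast ht) (nextPoint_mem hrank hlmo hs)) hc)
    ring
  have hint' := integral_mono_ae (((hi0.const_mul (1 - 1 / (T : ℝ))).sub
    (hie.const_mul (1 / (T : ℝ) / (2 * c)))).add (integrable_const _)) hi1 hle
  rw [integral_add' ((hi0.const_mul _).sub (hie.const_mul _)) (integrable_const _),
    integral_sub' (hi0.const_mul _) (hie.const_mul _), integral_const_mul, integral_const_mul,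
    integral_const] at hint'
  simp only [probReal_univ, one_smul] at hint'
  have hcoef : 0 ≤ 1 / (T : ℝ) / (2 * c) := by positivity
  have hmul := mul_le_mul_of_nonneg_left hEB hcoef
  rw [e0, e1]
  refine le_trans ?_ hint'
  have e2 : 1 / (T : ℝ) * (c * r + B / (2 * c)) = 1 / T * (c * r) + 1 / T / (2 * c) * B := by ring
  rw [e2]
  linarith

/-- A contraction `a_{t+1} ≥ (1 - 1/T) a_t + Φ/T - E` loses at most a factor `1 - 1/e` and `T E`. -/
theorem one_sub_exp_mul_le_of_recurrence {a : ℕ → ℝ} {T : ℕ} (hT : T ≠ 0) {Φ E : ℝ}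
    (hΦ : 0 ≤ Φ) (h0 : 0 ≤ a 0) (hE : 0 ≤ E)
    (h : ∀ t < T, (1 - 1 / T) * a t + 1 / T * Φ - E ≤ a (t + 1)) :
    (1 - 1 / Real.exp 1) * Φ - T * E ≤ a T := by
  have hT1 : (1 : ℝ) ≤ T := by exact_mod_cast Nat.one_le_iff_ne_zero.2 hT
  have hq0 : 0 ≤ 1 - 1 / (T : ℝ) := by
    rw [sub_nonneg, div_le_one (by linarith)]; exact hT1
  have hq1 : 1 - 1 / (T : ℝ) ≤ 1 := by
    have : 0 ≤ 1 / (T : ℝ) := by positivity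
    linarith
  have key : ∀ t ≤ T, Φ - a t ≤ (1 - 1 / (T : ℝ)) ^ t * Φ + t * E := by
    intro t
    induction t with
    | zero => intro _; simp; exact h0
    | succ t ih =>
      intro ht
      have h1 := h t (by omega)
      have h2 := mul_le_mul_of_nonneg_left (ih (by omega)) hq0
      have h3 : (1 - 1 / (T : ℝ)) * (t * E) ≤ 1 * (t * E) :=
        mul_le_mul_of_nonneg_right hq1 (by positivity)
      rw [pow_succ']
      push_cast
      linarith
  have hexp : (1 - 1 / (T : ℝ)) ^ T ≤ 1 / Real.exp 1 := by
    rw [one_div (Real.exp 1), ← Real.exp_neg]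
    exact Real.one_sub_div_pow_le_exp_neg hT1
  have h1 := key T le_rfl
  have h2 := mul_le_mul_of_nonneg_right hexp hΦ
  linarith

/-- Optimizing the parameter in Young's inequality. -/
theorem le_two_mul_of_forall_pos_le {X a q : ℝ} (ha : 0 < a) (hq : 0 ≤ q)
    (h : ∀ c > 0, X ≤ a * c + a * q ^ 2 / c) : X ≤ 2 * a * q := by
  rcases hq.eq_or_lt with rfl | hq
  · by_contra! hX
    rw [mul_zero] at hX
    -- For q = 0 the choice c = q is not allowed; this c gives X ≤ X/2, contradicting X > 0.
    have h1 := h (X / (2 * a)) (by positivity)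
    have h2 : a * (X / (2 * a)) = X / 2 := by field_simp
    rw [h2] at h1
    simp at h1
    linarith
  · have h1 := h q hq
    have h2 : a * q ^ 2 / q = a * q := by field_simp
    linarith

end Guarantee

end SCGPP

/-! ### The theorem: substitution of the parameters -/

theorem mainTheorem5 {d : ℕ} {Γ : Type*} [MeasurableSpace Γ]
    -- the stochastic set function
    (μ : MeasureTheory.Measure Γ) [MeasureTheory.IsProbabilityMeasure μ]
    (fγ : Γ → Finset (Fin d) → ℝ)
    (hmeas : ∀ S, Measurable fun γ => fγ γ S)
    (hint : ∀ S, MeasureTheory.Integrable (fun γ => fγ γ S) μ)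
    (hnonneg : ∀ S, 0 ≤ SCGPP.meanSetFn μ fγ S)
    (hmono : Monotone (SCGPP.meanSetFn μ fγ))
    (hsub : SCGPP.IsSubmodular (SCGPP.meanSetFn μ fγ))
    (Df : ℝ) (hDf : SCGPP.HasBoundedMarginals μ fγ Df)
    -- the matroid constraint
    (𝓘 : Matroid (Fin d)) (r : ℕ) (hr : 1 ≤ r) (hrank : 𝓘.eRank = (r : ℕ∞))
    -- the parameters of the algorithm
    (ε : ℝ) (hε : 0 < ε) (T M₀ M : ℕ) (hT : (T : ℝ) = 1 / ε) (hM : (M : ℝ) = 2 / ε)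
    (hM₀ : M₀ = ⌈1 / (2 * (r : ℝ) ^ 2 * ε ^ 2)⌉₊)
    (lmo : (Fin d → ℝ) → (Fin d → ℝ)) (hlmo_meas : Measurable lmo)
    (hlmo : SCGPP.IsArgmaxOracle (SCGPP.matroidPolytope 𝓘) lmo)
    -- an optimal point
    (xstar : Fin d → ℝ) (hxstar : xstar ∈ SCGPP.matroidPolytope 𝓘)
    (hmax : IsMaxOn (SCGPP.multilinearExt (SCGPP.meanSetFn μ fγ))
      (SCGPP.matroidPolytope 𝓘) xstar) :
    -- the Hessian estimator is unbiased
    (∀ x ∈ Set.Icc (0 : Fin d → ℝ) 1, ∀ i j : Fin d,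
      MeasureTheory.Integrable (fun ω => SCGPP.hessSample fγ ω i j) (SCGPP.sampleLaw μ x) ∧
      ∫ ω, SCGPP.hessSample fγ ω i j ∂(SCGPP.sampleLaw μ x) =
        SCGPP.hessianEntry (SCGPP.multilinearExt (SCGPP.meanSetFn μ fγ)) x i j) ∧
    -- the guarantee for the output
    MeasureTheory.Integrable (SCGPP.multilinearExt (SCGPP.meanSetFn μ fγ))
      (SCGPP.iterateLaw μ fγ T M₀ M lmo T) ∧
    (1 - 1 / Real.exp 1) * SCGPP.multilinearExt (SCGPP.meanSetFn μ fγ) xstar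
        - 6 * Real.sqrt ((r : ℝ) ^ 3 * d) * Df * ε
      ≤ ∫ x, SCGPP.multilinearExt (SCGPP.meanSetFn μ fγ) x
          ∂(SCGPP.iterateLaw μ fγ T M₀ M lmo T) := by
  refine ⟨fun x hx i j => ?_, SCGPP.integrable_multilinearExt_iterateLaw hmeas hlmo_meas hrank hlmo
    _ T M₀ M T, ?_⟩
  · rw [SCGPP.hessianEntry_multilinearExt]
    exact SCGPP.hessSample_unbiased hint hx i j
  have hr1 : (1 : ℝ) ≤ r := by exact_mod_cast hr
  have hrd : (r : ℝ) ≤ d := by exact_mod_cast SCGPP.rank_le_card hrank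
  have hTpos : (0 : ℝ) < T := by rw [hT]; positivity
  have hMpos : (0 : ℝ) < M := by rw [hM]; positivity
  have hM₀le : 1 / (2 * (r : ℝ) ^ 2 * ε ^ 2) ≤ M₀ := hM₀ ▸ Nat.le_ceil _
  have hM₀inv : (M₀ : ℝ)⁻¹ ≤ 2 * (r : ℝ) ^ 2 * ε ^ 2 := by
    refine inv_le_of_inv_le₀ (by positivity) ?_
    simpa using hM₀le
  have hM₀pos : (0 : ℝ) < M₀ := lt_of_lt_of_le (by positivity) hM₀le
  have hT0 : T ≠ 0 := by exact_mod_cast hTpos.ne'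
  have hM0 : M ≠ 0 := by exact_mod_cast hMpos.ne'
  have hM₀0 : M₀ ≠ 0 := by exact_mod_cast hM₀pos.ne'
  have hD := hDf.1
  -- Chosen so that the error bound 4 d r² ε² Df² equals 2 r q²; the Young terms then become r c + r
  -- q²/c, with optimum 2 r q.
  set q := Real.sqrt (2 * r * d) * Df * ε with hq
  have hq0 : 0 ≤ q := by positivity
  have hqsq : q ^ 2 = 2 * r * d * Df ^ 2 * ε ^ 2 := by
    rw [hq, mul_pow, mul_pow, Real.sq_sqrt (by positivity)]
  have hTε : 1 / (T : ℝ) = ε := by rw [hT]; simp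
  -- The initial batch and the T rounds each contribute at most 2 d r² ε² Df².
  have herr : ∀ t < T, ∫⁻ s, ENNReal.ofReal (SCGPP.gradError (SCGPP.meanSetFn μ fγ) s)
      ∂(SCGPP.stateLaw μ fγ T M₀ M lmo t) ≤ ENNReal.ofReal (2 * r * q ^ 2) := by
    intro t ht
    refine (SCGPP.lintegral_gradError_stateLaw_le hmeas hint hDf hlmo_meas hrank hlmo hM₀0 hM0
      ht).trans (ENNReal.ofReal_le_ofReal ?_)
    have h1 : (d : ℝ) * ((M₀ : ℝ)⁻¹ * Df ^ 2) ≤ d * (2 * (r : ℝ) ^ 2 * ε ^ 2 * Df ^ 2) := by gcongr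
    have h2 : (t : ℝ) ≤ T := by exact_mod_cast ht.le
    have h3 : (t : ℝ) * (d * ((M : ℝ)⁻¹ * ((2 * (r / T)) ^ 2 * Df ^ 2))) ≤
        T * (d * ((M : ℝ)⁻¹ * ((2 * (r / T)) ^ 2 * Df ^ 2))) := by gcongr
    have h4 : (T : ℝ) * (d * ((M : ℝ)⁻¹ * ((2 * (r / T)) ^ 2 * Df ^ 2))) =
        d * (2 * (r : ℝ) ^ 2 * ε ^ 2 * Df ^ 2) := by
      rw [hM, hT]; field_simp
    rw [hqsq]
    linarith
  have hstart : 0 ≤ ∫ x, SCGPP.multilinearExt (SCGPP.meanSetFn μ fγ) x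
      ∂(SCGPP.iterateLaw μ fγ T M₀ M lmo 0) := by
    rw [SCGPP.iterateLaw, integral_dirac, SCGPP.multilinearExt_zero]
    exact hnonneg ∅
  have hstar : 0 ≤ SCGPP.multilinearExt (SCGPP.meanSetFn μ fγ) xstar := by
    have := SCGPP.multilinearExt_mono hnonneg (SCGPP.matroidPolytope_subset hrank hxstar).1
    rwa [SCGPP.multilinearExt_const] at this
  have hX := SCGPP.le_two_mul_of_forall_pos_le (a := r)
    (X := (1 - 1 / Real.exp 1) * SCGPP.multilinearExt (SCGPP.meanSetFn μ fγ) xstar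
      - Df / 2 * r ^ 2 * ε - ∫ x, SCGPP.multilinearExt (SCGPP.meanSetFn μ fγ) x
          ∂(SCGPP.iterateLaw μ fγ T M₀ M lmo T)) (by linarith) hq0 fun c hc => by
    have h1 := SCGPP.one_sub_exp_mul_le_of_recurrence hT0 hstar hstart
      (E := 1 / T * (c * r + 2 * r * q ^ 2 / (2 * c)) + Df / 2 * (r / T) ^ 2) (by positivity)
      fun t ht => SCGPP.integral_iterateLaw_succ_ge hmeas hint hmono hsub hDf hlmo_meas hrank hlmo
        hxstar ht (by positivity) (herr t ht) hc
    have h2 : (T : ℝ) * (1 / T * (c * r + 2 * r * q ^ 2 / (2 * c)) + Df / 2 * (r / T) ^ 2) =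
        r * c + r * q ^ 2 / c + Df / 2 * r ^ 2 * ε := by
      rw [hT]; field_simp
    rw [h2] at h1
    linarith
  -- Gradient noise costs 2 r q ≤ 4 w Df ε, and the curvature term Df r² ε/2 is at most w Df ε/2
  -- because r ≤ d; together they stay below 6 w Df ε.
  set w := Real.sqrt ((r : ℝ) ^ 3 * d) with hw
  have hw1 : 2 * r * q ≤ 4 * w * Df * ε := by
    have : (r : ℝ) * Real.sqrt (2 * r * d) ≤ 2 * w := by
      rw [hw]
      refine le_of_sq_le_sq ?_ (by positivity)
      rw [mul_pow, mul_pow, Real.sq_sqrt (by positivity), Real.sq_sqrt (by positivity)]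
      have : 0 ≤ (r : ℝ) ^ 3 * d := by positivity
      linarith
    have := mul_le_mul_of_nonneg_right this (mul_nonneg hD hε.le)
    rw [hq]
    linarith
  have hw2 : (r : ℝ) ^ 2 ≤ w := by
    refine Real.le_sqrt_of_sq_le ?_
    have := mul_le_mul_of_nonneg_left hrd (by positivity : 0 ≤ (r : ℝ) ^ 3)
    linarith
  have hw3 := mul_le_mul_of_nonneg_right hw2 (mul_nonneg hD hε.le)
  have hw4 : 0 ≤ w * (Df * ε) := mul_nonneg (Real.sqrt_nonneg _) (mul_nonneg hD hε.le)
  linarith
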